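/- Let $B_0=\mathbb{Z}[\tfrac13,\nu,(\nu^3-1)^{-1}]$ and $B=B_0[\omega]/(1+\omega+\omega^2)$, and put $S_0=\operatorname{Spec}(B_0)$ and $S=\operatorname{Spec}(B)$. Let $C_0$ be the elliptic curve over $S_0$ given by the Weierstrass equation $$y^2+3\nu xy+(\nu^3-1)y=x^3$$ (its discriminant $27(\nu^3-1)^3$ is a unit), and let $C=C_0\times_{S_0}S$. For a Weierstrass curve $E$ over a ring $R$, let $F$ be the formal group law of $E$ (the formal completion of $E$ at its origin) in the parameter $z=-x/y$, let $[p]_F(z)\in R[[z]]$ be its multiplication-by-$p$ series, and let $v_k$ be the coefficient of $z^{p^k}$ in $[p]_F(z)$, so that $v_0=p$. The curve $E$ is called Landweber exact if, for every prime $p$ and every $n\ge 0$, the element $v_n$ is a nonzerodivisor in $R/(v_0,\dots,v_{n-1})$ (these quotients may be zero). If $p=0$ in $R$, the Hasse invariant of $E$ (with respect to $z$) is the tangent map at the origin of the Verschiebung $V\colon E^{(p)}\to E$, that is, the coefficient of $z^p$ in $[p]_F(z)=V(z^p)$. **Proposition.** The elliptic curve $C$ over $S$ is Landweber exact. Moreover,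 every prime $p$ is a nonzerodivisor in $B_0$, and for every prime $p\neq 3$ the Hasse invariant of the reduction of $C_0$ modulo $p$ is a nonzerodivisor in $B_0/p$. -/

import Mathlib

open scoped Polynomial

noncomputable section

/-! ### One-dimensional formal group laws: multiplication series and Landweber exactness -/

namespace LevelThree

/-- For a formal group law `F(X, Y)` over `R`, the series `[n]_F(z)`, given by `[0]_F(z) = 0` and
`[n + 1]_F(z) = F([n]_F(z), z)`. -/
def multSeries {R : Type*} [CommRing R] (F : MvPowerSeries (Fin 2) R) : ℕ → PowerSeries R
  | 0 => 0
  | n + 1 => F.subst ![multSeries F n, PowerSeries.X]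

/-- The coefficient `v_k` of `z ^ (p ^ k)` in `[p]_F(z)`. In particular `v_0 = p`. -/
def landweberCoeff {R : Type*} [CommRing R] (F : MvPowerSeries (Fin 2) R) (p k : ℕ) : R :=
  PowerSeries.coeff (p ^ k) (multSeries F p)

/-- The ideal `(v_0, v_1, …, v_{n - 1})`, where `v_0 = p`. -/
def landweberIdeal {R : Type*} [CommRing R] (F : MvPowerSeries (Fin 2) R) (p n : ℕ) : Ideal R :=
  Ideal.span (landweberCoeff F p '' Set.Iio n)

/-- A formal group law `F` over `R` is Landweber exact if for every prime `p` the infinite sequence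
`p = v_0, v_1, v_2, …` is regular on `R`: each `v_n` is a nonzerodivisor on
`R / (v_0, …, v_{n - 1})`. The quotients are allowed to vanish. -/
def IsLandweberExact {R : Type*} [CommRing R] (F : MvPowerSeries (Fin 2) R) : Prop :=
  ∀ p : ℕ, p.Prime → ∀ n : ℕ,
    Ideal.Quotient.mk (landweberIdeal F p n) (landweberCoeff F p n) ∈
      nonZeroDivisors (R ⧸ landweberIdeal F p n)

end LevelThree

/-! ### The formal group law of a Weierstrass curve

Near the origin `O = [0 : 1 : 0]` use the coordinates `z = -x / y` and `w = -1 / y`, in which the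
Weierstrass equation reads
`w = z³ + a₁ z w + a₂ z² w + a₃ w² + a₄ z w² + a₆ w³`
and `O` is the point `z = w = 0`. -/

namespace WeierstrassCurve

variable {R : Type*} [CommRing R] (W : WeierstrassCurve R)

/-- The right-hand side of the Weierstrass equation in the coordinates `(z, w)`. -/
def formalStep (w : PowerSeries R) : PowerSeries R :=
  PowerSeries.X ^ 3 + PowerSeries.C W.a₁ * PowerSeries.X * w
    + PowerSeries.C W.a₂ * PowerSeries.X ^ 2 * w + PowerSeries.C W.a₃ * w ^ 2
    + PowerSeries.C W.a₄ * PowerSeries.X * w ^ 2 + PowerSeries.C W.a₆ * w ^ 3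

/-- The expansion `w(z) = z³ + ⋯` of `w` in terms of `z` at `O`: the fixed point of `formalStep`
obtained by iterating it on `0`. The `n`-th coefficient is constant from the `n`-th iterate on. -/
def formalW : PowerSeries R :=
  PowerSeries.mk fun n => PowerSeries.coeff n (W.formalStep^[n] 0)

/-- The slope `λ(z₁, z₂) = (w(z₁) - w(z₂)) / (z₁ - z₂)` of the line through the points with
parameters `z₁` and `z₂`. As `(z₁ⁿ - z₂ⁿ) / (z₁ - z₂)` is the sum of the `z₁ ^ i * z₂ ^ j` with
`i + j + 1 = n`, the coefficient of `z₁ ^ i * z₂ ^ j` is the coefficient of `z ^ (i + j + 1)` in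
`w(z)`. -/
def formalSlope : MvPowerSeries (Fin 2) R :=
  fun d => PowerSeries.coeff (d 0 + d 1 + 1) W.formalW

/-- The intercept `w(z₁) - λ z₁` of the line `w = λ z + intercept` through the two points. -/
def formalIntercept : MvPowerSeries (Fin 2) R :=
  W.formalW.subst (MvPowerSeries.X 0 : MvPowerSeries (Fin 2) R)
    - W.formalSlope * MvPowerSeries.X 0

/-- The `z`-coordinate of the third point of intersection of the curve with the line through the
points with parameters `z₁` and `z₂`: substituting `w = l z + m` in the equation gives a cubic
polynomial in `z` with leading coefficient `1 + a₂ l + a₄ l² + a₆ l³` and next coefficient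
`a₁ l + a₂ m + a₃ l² + 2 a₄ l m + 3 a₆ l² m`. -/
def formalThird : MvPowerSeries (Fin 2) R :=
  let l := W.formalSlope
  let m := W.formalIntercept
  let c (r : R) : MvPowerSeries (Fin 2) R := MvPowerSeries.C r
  (-MvPowerSeries.X 0 - MvPowerSeries.X 1)
    - (c W.a₁ * l + c W.a₂ * m + c W.a₃ * l ^ 2 + 2 * c W.a₄ * l * m + 3 * c W.a₆ * l ^ 2 * m)
      * MvPowerSeries.invOfUnit (1 + c W.a₂ * l + c W.a₄ * l ^ 2 + c W.a₆ * l ^ 3) 1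

/-- The formal group law `F(z₁, z₂)` of the curve (its formal completion at `O`) in the parameter
`z = -x / y`: the negative of the third point of intersection, where negation
`(x, y) ↦ (x, -y - a₁ x - a₃)` is `z ↦ -z / (1 - a₁ z - a₃ w(z))`. -/
def formalGroupLaw : MvPowerSeries (Fin 2) R :=
  -W.formalThird
    * MvPowerSeries.invOfUnit
        (1 - MvPowerSeries.C W.a₁ * W.formalThird
          - MvPowerSeries.C W.a₃ * W.formalW.subst W.formalThird) 1

/-- A Weierstrass curve is Landweber exact if its formal group law is. -/
def IsLandweberExact : Prop :=
  LevelThree.IsLandweberExact W.formalGroupLaw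

/-- The Hasse invariant of a Weierstrass curve `E` over a ring `R` of characteristic `p`, with
respect to the parameter `z` at `O` (equivalently, to the invariant differential that is `dz` at
`O`). The Verschiebung `V : E^(p) → E` satisfies `V ∘ Frobenius = [p]`, so that `[p](z) = V(z ^ p)`
on formal groups, and the Hasse invariant is the tangent map `V'(0)` of the Verschiebung, which is
the coefficient of `z ^ p` in `[p](z)`. -/
def hasseInvariant (p : ℕ) : R :=
  PowerSeries.coeff p (LevelThree.multSeries W.formalGroupLaw p)

end WeierstrassCurve

/-! ### The curve -/

namespace LevelThree

/-- The ring `B₀ = ℤ[1/3, ν, (ν³ - 1)⁻¹]` of functions on `S₀ = 𝔸¹ ∖ μ₃` over `ℤ[1/3]`. -/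
abbrev B₀ : Type := Localization.Away (3 * (Polynomial.X ^ 3 - 1) : ℤ[X])

/-- The coordinate `ν`. -/
def ν : B₀ := algebraMap ℤ[X] B₀ Polynomial.X

/-- The ring `B = B₀[ω] / (1 + ω + ω²)` of functions on `S`. -/
abbrev B : Type := AdjoinRoot (1 + Polynomial.X + Polynomial.X ^ 2 : B₀[X])

/-- The curve `y² + 3 ν x y + (ν³ - 1) y = x³` over `S₀`. -/
def C₀ : WeierstrassCurve B₀ where
  a₁ := 3 * ν
  a₂ := 0
  a₃ := ν ^ 3 - 1
  a₄ := 0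
  a₆ := 0

/-- The curve `C = C₀ ×_{S₀} S` over `S`. -/
def C : WeierstrassCurve B := C₀.map (algebraMap B₀ B)

theorem isUnit_three_mul : IsUnit (3 * (ν ^ 3 - 1) : B₀) := by
  have h := IsLocalization.Away.algebraMap_isUnit (S := B₀)
    (3 * (Polynomial.X ^ 3 - 1) : ℤ[X])
  simpa only [ν, map_mul, map_sub, map_pow, map_one, map_ofNat] using h

instance : C₀.IsElliptic where
  isUnit := by
    have h3 : IsUnit (3 : B₀) := isUnit_of_mul_isUnit_left isUnit_three_mul
    have h := (h3.pow 3).mul ((isUnit_of_mul_isUnit_right isUnit_three_mul).pow 3)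
    have e : C₀.Δ = 3 ^ 3 * (ν ^ 3 - 1) ^ 3 := by
      simp only [WeierstrassCurve.Δ, WeierstrassCurve.b₂, WeierstrassCurve.b₄,
        WeierstrassCurve.b₆, WeierstrassCurve.b₈, C₀]
      ring
    rwa [e]

instance : C.IsElliptic := inferInstanceAs (C₀.map (algebraMap B₀ B)).IsElliptic

end LevelThree

end

/-! Everything rests on three facts about v_0, v_1, v_2. The element p is regular because B₀ is a
localization of ℤ[ν] and B is free over B₀; if p = 3 it is a unit and all later quotients vanish.
For p ≠ 3 the ring B₀/p is a localization of the domain 𝔽_p[ν], so v_1 only has to be nonzero modulo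
p. This is checked at ν = 1, outside S₀, where the Weierstrass cubic acquires a node, its formal
group becomes multiplicative and -3 v_1 = (-3)^p (`neg_mul_coeff_multSeries`). Finally p, v_1, v_2
generate the unit ideal, because over a field of characteristic p the formal height is at most 2
(`coeff_sq_multSeries_ne_zero`).

The height bound compares two estimates of the order of [p](z). If v_1 = 0, a derivative argument
for endomorphisms, applied twice, shows that [p] is a series in z^(p²)
(`natCast_mul_coeff_eq_zero_of_endomorphism`); if v_2 = 0 as well, its order exceeds p². On the
other hand x(pP) is a quotient of polynomials in x(P) of degree at most p² (`exists_xRep_prime`),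
and x has a double pole at O, so the order is at most p². The degree bound is the parallelogram
inequality h(n) + h(n+2) ≤ 2 h(n+1) + 2 for the naive height. That pP ≠ O is read off at x = 0,
where the curve has a point of order three and 3 ∤ p.

The identities satisfied by the formal group law are not computed. Formal parameters embed into the
points of the curve over the fraction field of a power series ring (`formalPoint`), and the known
group law there is pulled back (`formalPoint_add`). -/

noncomputable section

/-! ### Substitution of pairs of power series -/

namespace MvPowerSeries

variable {σ R : Type*} [CommRing R]

theorem hasSubst_pair {s t : MvPowerSeries σ R} (hs : constantCoeff s = 0)
    (ht : constantCoeff t = 0) : HasSubst ![s, t] :=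
  hasSubst_of_constantCoeff_zero fun i => by fin_cases i <;> simpa

theorem constantCoeff_subst_pair {F : MvPowerSeries (Fin 2) R} (hF : constantCoeff F = 0)
    {s t : MvPowerSeries σ R} (hs : constantCoeff s = 0) (ht : constantCoeff t = 0) :
    constantCoeff (F.subst ![s, t]) = 0 :=
  constantCoeff_subst_eq_zero (hasSubst_pair hs ht) (fun i => by fin_cases i <;> simpa) hF

theorem subst_pair_X (F : MvPowerSeries (Fin 2) R) : F.subst ![X 0, X 1] = F := by
  have h : (![X 0, X 1] : Fin 2 → MvPowerSeries (Fin 2) R) = X := by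
    ext i : 1
    fin_cases i <;> rfl
  rw [h, subst_self, id]

theorem subst_subst_pair {τ : Type*} {s t : MvPowerSeries σ R} (hs : constantCoeff s = 0)
    (ht : constantCoeff t = 0) {b : σ → MvPowerSeries τ R} (hb : HasSubst b)
    (F : MvPowerSeries (Fin 2) R) :
    (F.subst ![s, t]).subst b = F.subst ![s.subst b, t.subst b] := by
  rw [subst_comp_subst_apply (hasSubst_pair hs ht) hb]
  congr 1
  ext i : 1
  fin_cases i <;> rfl

theorem subst_powerSeries_subst {τ : Type*} {s : MvPowerSeries σ R} (hs : constantCoeff s = 0)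
    {b : σ → MvPowerSeries τ R} (hb : HasSubst b) (f : PowerSeries R) :
    (f.subst s).subst b = f.subst (s.subst b) := by
  exact subst_comp_subst_apply
    (PowerSeries.HasSubst.of_constantCoeff_zero hs).const hb f

theorem subst_pair_powerSeries_subst {g h : PowerSeries R} (hg : PowerSeries.constantCoeff g = 0)
    (hh : PowerSeries.constantCoeff h = 0) {s : MvPowerSeries σ R} (hs : constantCoeff s = 0)
    (F : MvPowerSeries (Fin 2) R) :
    PowerSeries.subst s (F.subst ![g, h] : PowerSeries R) = F.subst ![g.subst s, h.subst s] :=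
  subst_subst_pair hg hh
    (PowerSeries.hasSubst_iff.mp (PowerSeries.HasSubst.of_constantCoeff_zero hs)) F

theorem constantCoeff_eq_one_isUnit {s : MvPowerSeries σ R} (h : constantCoeff s = 1) :
    IsUnit s := by
  rw [isUnit_iff_constantCoeff, h]
  exact isUnit_one

end MvPowerSeries

/-! ### Divided differences -/

namespace PowerSeries

variable {σ R : Type*} [CommRing R]

/-- The divided difference `(f(z₁) - f(z₂)) / (z₁ - z₂)` of a power series. -/
def divDiff (f : PowerSeries R) : MvPowerSeries (Fin 2) R :=
  fun d => coeff (d 0 + d 1 + 1) f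

theorem coeff_divDiff (f : PowerSeries R) (d : Fin 2 →₀ ℕ) :
    MvPowerSeries.coeff d (divDiff f) = coeff (d 0 + d 1 + 1) f := rfl

theorem constantCoeff_divDiff (f : PowerSeries R) :
    MvPowerSeries.constantCoeff (divDiff f) = coeff 1 f := by
  rw [← MvPowerSeries.coeff_zero_eq_constantCoeff_apply, coeff_divDiff]
  simp

theorem X_sub_X_mul_divDiff (f : PowerSeries R) :
    (MvPowerSeries.X 0 - MvPowerSeries.X 1) * divDiff f =
      f.subst (MvPowerSeries.X 0 : MvPowerSeries (Fin 2) R) - f.subst (MvPowerSeries.X 1) := by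
  ext d
  rw [sub_mul, map_sub, map_sub, coeff_subst_single, coeff_subst_single, MvPowerSeries.X,
    MvPowerSeries.X, MvPowerSeries.coeff_monomial_mul, MvPowerSeries.coeff_monomial_mul]
  simp only [coeff_divDiff, one_mul, Finsupp.single_le_iff]
  have e0 : d = Finsupp.single 0 (d 0) ↔ d 1 = 0 := by
    constructor
    · intro h; rw [h]; simp
    · intro h; ext i; fin_cases i <;> simp [h]
  have e1 : d = Finsupp.single 1 (d 1) ↔ d 0 = 0 := by
    constructor
    · intro h; rw [h]; simp
    · intro h; ext i; fin_cases i <;> simp [h]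
  simp only [e0, e1]
  rcases h0 : d 0 with _ | a <;> rcases h1 : d 1 with _ | b <;>
    simp [h0, h1, add_comm, add_left_comm]

theorem sub_mul_divDiff_subst (f : PowerSeries R) {s t : MvPowerSeries σ R}
    (hs : MvPowerSeries.constantCoeff s = 0) (ht : MvPowerSeries.constantCoeff t = 0) :
    (s - t) * (divDiff f).subst ![s, t] = f.subst s - f.subst t := by
  have h := MvPowerSeries.hasSubst_pair hs ht
  have e := congrArg (MvPowerSeries.subst ![s, t]) (X_sub_X_mul_divDiff f)
  rw [MvPowerSeries.subst_mul h, MvPowerSeries.subst_sub h, MvPowerSeries.subst_sub h,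
    MvPowerSeries.subst_powerSeries_subst (by simp) h,
    MvPowerSeries.subst_powerSeries_subst (by simp) h,
    MvPowerSeries.subst_X h, MvPowerSeries.subst_X h] at e
  exact e

/-- On the diagonal the divided difference becomes the derivative: each of the n + 1 monomials of
degree n contributes the same coefficient of f. -/
theorem coeff_divDiff_subst_self (f : PowerSeries R) (n : ℕ) :
    coeff n ((divDiff f).subst ![(X : PowerSeries R), X] : PowerSeries R) =
      (n + 1) * coeff (n + 1) f := by
  have hX : MvPowerSeries.constantCoeff (X : PowerSeries R) = 0 := constantCoeff_X
  rw [coeff, MvPowerSeries.coeff_subst (MvPowerSeries.hasSubst_pair hX hX)]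
  let e : ℕ × ℕ → (Fin 2 →₀ ℕ) := fun x => Finsupp.single 0 x.1 + Finsupp.single 1 x.2
  rw [finsum_eq_sum_of_support_subset (s := (Finset.HasAntidiagonal.antidiagonal n).image e)]
  · rw [Finset.sum_image]
    · rw [Finset.sum_congr rfl (g := fun _ => coeff (n + 1) f)]
      · simp
      · intro x hx
        rw [Finset.HasAntidiagonal.mem_antidiagonal] at hx
        rw [coeff_divDiff, Finsupp.prod_fintype _ _ (by simp)]
        simp only [e, Fin.prod_univ_two, Matrix.cons_val_zero, Matrix.cons_val_one, ← pow_add]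
        simp [hx]
    · intro x _ y _ h
      have h0 := DFunLike.congr_fun h 0
      have h1 := DFunLike.congr_fun h 1
      simp [e] at h0 h1
      exact Prod.ext h0 h1
  · intro d hd
    rw [Function.mem_support, Finsupp.prod_fintype _ _ (by simp)] at hd
    simp only [Fin.prod_univ_two, Matrix.cons_val_zero, Matrix.cons_val_one, ← pow_add] at hd
    simp only [Finset.coe_image, Set.mem_image]
    refine ⟨(d 0, d 1), ?_, ?_⟩
    · by_contra hne
      refine hd ?_
      have h : coeff n (X ^ (d 0 + d 1) : PowerSeries R) = 0 := by
        rw [coeff_X_pow, if_neg]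
        intro h
        exact hne (by simp [h])
      erw [h]
      simp
    · ext i
      fin_cases i <;> simp [e]

end PowerSeries

/-! ### Expansion of the curve at the origin, chords and the formal group law -/

namespace WeierstrassCurve

/-- Weierstrass curves of the form `y² + a₁ x y + a₃ y = x³`, for which `(0, 0)` is a point of
order three. -/
class IsThreeTorsionForm {R : Type*} [CommRing R] (W : WeierstrassCurve R) : Prop where
  a₂ : W.a₂ = 0
  a₄ : W.a₄ = 0
  a₆ : W.a₆ = 0

attribute [simp] IsThreeTorsionForm.a₂ IsThreeTorsionForm.a₄ IsThreeTorsionForm.a₆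

section Ring

variable {σ R : Type*} [CommRing R] (W : WeierstrassCurve R)

instance {S : Type*} [CommRing S] (φ : R →+* S) [W.IsThreeTorsionForm] :
    (W.map φ).IsThreeTorsionForm := ⟨by simp, by simp, by simp⟩

/-- The equation `w = s³ + a₁ s w + a₃ w²` of the curve in the coordinates at infinity. -/
def FormalEquation (s w : MvPowerSeries σ R) : Prop :=
  w = s ^ 3 + MvPowerSeries.C W.a₁ * s * w + MvPowerSeries.C W.a₃ * w ^ 2

variable {W} in
-- The difference of the two equations is (w - w')(1 - a₁ s - a₃ (w + w')) = 0, whose second factor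
-- has constant term 1. Later expressions for w(s) are recognized through this uniqueness.
theorem FormalEquation.unique {s w w' : MvPowerSeries σ R} (h : W.FormalEquation s w)
    (h' : W.FormalEquation s w') (hs : MvPowerSeries.constantCoeff s = 0)
    (hw : MvPowerSeries.constantCoeff w = 0) (hw' : MvPowerSeries.constantCoeff w' = 0) :
    w = w' := by
  have hu : IsUnit (1 - MvPowerSeries.C W.a₁ * s - MvPowerSeries.C W.a₃ * (w + w')) :=
    MvPowerSeries.constantCoeff_eq_one_isUnit (by simp [hs, hw, hw'])
  unfold FormalEquation at h h'
  rw [← sub_eq_zero, ← hu.mul_left_eq_zero]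
  linear_combination h - h'

variable [W.IsThreeTorsionForm]

theorem formalStep_eq (w : PowerSeries R) : W.formalStep w =
    PowerSeries.X ^ 3 + PowerSeries.C W.a₁ * PowerSeries.X * w + PowerSeries.C W.a₃ * w ^ 2 := by
  simp [formalStep]

theorem X_dvd_formalStep_iterate (n : ℕ) : PowerSeries.X ∣ W.formalStep^[n] 0 := by
  induction n with
  | zero => simp
  | succ n ih =>
    rw [Function.iterate_succ_apply', formalStep_eq]
    obtain ⟨u, hu⟩ := ih
    rw [hu]
    exact ⟨PowerSeries.X ^ 2 + PowerSeries.C W.a₁ * (PowerSeries.X * u)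
      + PowerSeries.C W.a₃ * PowerSeries.X * u ^ 2, by ring⟩

/-- On series without constant term the step map is an X-adic contraction, so its iterates converge
and the limit `formalW` is a fixed point. -/
theorem X_pow_dvd_formalStep_sub {u v : PowerSeries R} {n : ℕ} (hu : PowerSeries.X ∣ u)
    (hv : PowerSeries.X ∣ v) (h : PowerSeries.X ^ n ∣ u - v) :
    PowerSeries.X ^ (n + 1) ∣ W.formalStep u - W.formalStep v := by
  have e : W.formalStep u - W.formalStep v =
      (u - v) * (PowerSeries.X * PowerSeries.C W.a₁ + PowerSeries.C W.a₃ * (u + v)) := by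
    rw [formalStep_eq, formalStep_eq]
    ring
  rw [e, pow_succ]
  exact mul_dvd_mul h (dvd_add (dvd_mul_right _ _) (Dvd.dvd.mul_left (dvd_add hu hv) _))

theorem X_pow_dvd_formalStep_iterate_sub (n : ℕ) :
    PowerSeries.X ^ (n + 1) ∣ W.formalStep^[n + 1] 0 - W.formalStep^[n] 0 := by
  induction n with
  | zero => simpa using W.X_dvd_formalStep_iterate 1
  | succ n ih =>
    have h := W.X_pow_dvd_formalStep_sub (W.X_dvd_formalStep_iterate (n + 1))
      (W.X_dvd_formalStep_iterate n) ih
    rwa [← Function.iterate_succ_apply' W.formalStep, ← Function.iterate_succ_apply' W.formalStep]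
      at h

theorem X_pow_dvd_formalW_sub (n : ℕ) :
    PowerSeries.X ^ (n + 1) ∣ W.formalW - W.formalStep^[n] 0 := by
  rw [PowerSeries.X_pow_dvd_iff]
  intro m hm
  rw [map_sub, sub_eq_zero, formalW, PowerSeries.coeff_mk]
  obtain ⟨j, rfl⟩ := Nat.exists_eq_add_of_le (Nat.lt_succ_iff.mp hm)
  clear hm
  induction j with
  | zero => rfl
  | succ j ih =>
    have h := (PowerSeries.X_pow_dvd_iff.mp (W.X_pow_dvd_formalStep_iterate_sub (m + j))) m
      (by omega)
    rw [map_sub, sub_eq_zero] at h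
    rw [ih, ← h, add_assoc]

theorem X_dvd_formalW : PowerSeries.X ∣ W.formalW := by
  simpa using W.X_pow_dvd_formalW_sub 0

theorem formalStep_formalW : W.formalStep W.formalW = W.formalW := by
  ext n
  have h1 := W.X_pow_dvd_formalStep_sub W.X_dvd_formalW (W.X_dvd_formalStep_iterate n)
    (W.X_pow_dvd_formalW_sub n)
  rw [← Function.iterate_succ_apply' W.formalStep n] at h1
  have h := (PowerSeries.X_pow_dvd_iff.mp
    (dvd_sub h1 (W.X_pow_dvd_formalW_sub (n + 1)))) n (by omega)
  rw [sub_sub_sub_cancel_right, map_sub, sub_eq_zero] at h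
  exact h

theorem formalW_eq : W.formalW = PowerSeries.X ^ 3 + PowerSeries.C W.a₁ * PowerSeries.X * W.formalW
    + PowerSeries.C W.a₃ * W.formalW ^ 2 := by
  conv_lhs => rw [← formalStep_formalW, formalStep_eq]

theorem constantCoeff_formalW : PowerSeries.constantCoeff W.formalW = 0 :=
  PowerSeries.X_dvd_iff.mp W.X_dvd_formalW

theorem formalW_mul_eq : W.formalW *
    (1 - PowerSeries.C W.a₁ * PowerSeries.X - PowerSeries.C W.a₃ * W.formalW) =
    PowerSeries.X ^ 3 := by
  linear_combination W.formalW_eq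

theorem X_pow_three_dvd_formalW : PowerSeries.X ^ 3 ∣ W.formalW := by
  have hu : IsUnit (1 - PowerSeries.C W.a₁ * PowerSeries.X - PowerSeries.C W.a₃ * W.formalW) := by
    rw [PowerSeries.isUnit_iff_constantCoeff]
    simp [constantCoeff_formalW]
  rw [← hu.dvd_mul_right, formalW_mul_eq]

theorem constantCoeff_formalSlope : MvPowerSeries.constantCoeff W.formalSlope = 0 := by
  have := (PowerSeries.X_pow_dvd_iff.mp W.X_pow_three_dvd_formalW) 1 (by norm_num)
  rw [← this]
  exact PowerSeries.constantCoeff_divDiff W.formalW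

/-- The expansion `w(s)` of `w` at a power series `s` without constant term. -/
abbrev wAt (s : MvPowerSeries σ R) : MvPowerSeries σ R := W.formalW.subst s

variable {s t : MvPowerSeries σ R}

theorem constantCoeff_wAt (hs : MvPowerSeries.constantCoeff s = 0) :
    MvPowerSeries.constantCoeff (W.wAt s) = 0 :=
  PowerSeries.constantCoeff_subst_eq_zero hs _ W.constantCoeff_formalW

theorem formalEquation_wAt (hs : MvPowerSeries.constantCoeff s = 0) :
    W.FormalEquation s (W.wAt s) := by
  have h := PowerSeries.HasSubst.of_constantCoeff_zero hs
  have e := congrArg (PowerSeries.subst s) W.formalW_eq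
  rwa [PowerSeries.subst_add h, PowerSeries.subst_add h, PowerSeries.subst_mul h,
    PowerSeries.subst_mul h, PowerSeries.subst_mul h, PowerSeries.subst_pow h,
    PowerSeries.subst_pow h, PowerSeries.subst_X h, PowerSeries.subst_C, PowerSeries.subst_C] at e

theorem eq_wAt {w : MvPowerSeries σ R} (h : W.FormalEquation s w)
    (hs : MvPowerSeries.constantCoeff s = 0) (hw : MvPowerSeries.constantCoeff w = 0) :
    W.wAt s = w :=
  (W.formalEquation_wAt hs).unique h hs (W.constantCoeff_wAt hs) hw

theorem isUnit_wAt (hs : MvPowerSeries.constantCoeff s = 0) :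
    IsUnit (1 - MvPowerSeries.C W.a₁ * s - MvPowerSeries.C W.a₃ * W.wAt s) :=
  MvPowerSeries.constantCoeff_eq_one_isUnit (by simp [hs, W.constantCoeff_wAt hs])

theorem wAt_mul (hs : MvPowerSeries.constantCoeff s = 0) :
    W.wAt s * (1 - MvPowerSeries.C W.a₁ * s - MvPowerSeries.C W.a₃ * W.wAt s) = s ^ 3 := by
  have h := W.formalEquation_wAt hs
  unfold FormalEquation at h
  linear_combination h

omit [W.IsThreeTorsionForm] in
theorem wAt_subst {τ : Type*} (hs : MvPowerSeries.constantCoeff s = 0)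
    {b : σ → MvPowerSeries τ R} (hb : MvPowerSeries.HasSubst b) :
    (W.wAt s).subst b = W.wAt (s.subst b) :=
  MvPowerSeries.subst_powerSeries_subst hs hb _

/-- The slope of the line through the points with parameters `s` and `t`. -/
abbrev slopeAt (s t : MvPowerSeries σ R) : MvPowerSeries σ R := W.formalSlope.subst ![s, t]

/-- The intercept of the line through the points with parameters `s` and `t`. -/
abbrev interceptAt (s t : MvPowerSeries σ R) : MvPowerSeries σ R := W.wAt s - W.slopeAt s t * s

/-- The third point on the line through the points with parameters `s` and `t`. -/
def thirdAt (s t : MvPowerSeries σ R) : MvPowerSeries σ R :=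
  -s - t - (MvPowerSeries.C W.a₁ * W.slopeAt s t + MvPowerSeries.C W.a₃ * W.slopeAt s t ^ 2)

theorem constantCoeff_slopeAt (hs : MvPowerSeries.constantCoeff s = 0)
    (ht : MvPowerSeries.constantCoeff t = 0) : MvPowerSeries.constantCoeff (W.slopeAt s t) = 0 :=
  MvPowerSeries.constantCoeff_subst_pair W.constantCoeff_formalSlope hs ht

theorem constantCoeff_thirdAt (hs : MvPowerSeries.constantCoeff s = 0)
    (ht : MvPowerSeries.constantCoeff t = 0) : MvPowerSeries.constantCoeff (W.thirdAt s t) = 0 := by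
  simp [thirdAt, hs, ht, W.constantCoeff_slopeAt hs ht]

omit [W.IsThreeTorsionForm] in
theorem sub_mul_slopeAt (hs : MvPowerSeries.constantCoeff s = 0)
    (ht : MvPowerSeries.constantCoeff t = 0) :
    (s - t) * W.slopeAt s t = W.wAt s - W.wAt t :=
  PowerSeries.sub_mul_divDiff_subst W.formalW hs ht

/-- With a₂ = a₄ = a₆ = 0 the cubic cut out on a line is monic, so the inverse series in the
definition is 1. -/
theorem formalThird_eq :
    W.formalThird = W.thirdAt (MvPowerSeries.X 0) (MvPowerSeries.X 1) := by
  have h1 : MvPowerSeries.invOfUnit (1 : MvPowerSeries (Fin 2) R) 1 = 1 := by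
    have h := MvPowerSeries.mul_invOfUnit (1 : MvPowerSeries (Fin 2) R) 1 (by simp)
    rwa [one_mul] at h
  simp only [formalThird, thirdAt, slopeAt, MvPowerSeries.subst_pair_X]
  simp [h1]

theorem formalGroupLaw_mul : W.formalGroupLaw * (1 - MvPowerSeries.C W.a₁ * W.formalThird
    - MvPowerSeries.C W.a₃ * W.wAt W.formalThird) = -W.formalThird := by
  have h0 : MvPowerSeries.constantCoeff W.formalThird = 0 := by
    rw [formalThird_eq]
    exact W.constantCoeff_thirdAt (by simp) (by simp)
  rw [formalGroupLaw, mul_assoc, MvPowerSeries.invOfUnit_mul, mul_one]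
  simp [h0, W.constantCoeff_wAt h0]

theorem constantCoeff_formalGroupLaw : MvPowerSeries.constantCoeff W.formalGroupLaw = 0 := by
  have h0 : MvPowerSeries.constantCoeff W.formalThird = 0 := by
    rw [formalThird_eq]
    exact W.constantCoeff_thirdAt (by simp) (by simp)
  have h := congrArg MvPowerSeries.constantCoeff W.formalGroupLaw_mul
  simpa [h0, W.constantCoeff_wAt h0] using h

omit [W.IsThreeTorsionForm] in
theorem thirdAt_subst {τ : Type*} (hs : MvPowerSeries.constantCoeff s = 0)
    (ht : MvPowerSeries.constantCoeff t = 0) {b : σ → MvPowerSeries τ R}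
    (hb : MvPowerSeries.HasSubst b) :
    (W.thirdAt s t).subst b = W.thirdAt (s.subst b) (t.subst b) := by
  simp only [thirdAt, slopeAt]
  rw [← MvPowerSeries.subst_subst_pair hs ht hb, ← MvPowerSeries.coe_substAlgHom hb]
  simp only [map_sub, map_neg, map_add, map_mul, map_pow]
  simp only [MvPowerSeries.coe_substAlgHom, MvPowerSeries.subst_C]

/-- The sum `F(s, t)` for the formal group law `F` of the curve. -/
abbrev addAt (s t : MvPowerSeries σ R) : MvPowerSeries σ R := W.formalGroupLaw.subst ![s, t]

theorem constantCoeff_addAt (hs : MvPowerSeries.constantCoeff s = 0)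
    (ht : MvPowerSeries.constantCoeff t = 0) : MvPowerSeries.constantCoeff (W.addAt s t) = 0 :=
  MvPowerSeries.constantCoeff_subst_pair W.constantCoeff_formalGroupLaw hs ht

theorem addAt_mul (hs : MvPowerSeries.constantCoeff s = 0)
    (ht : MvPowerSeries.constantCoeff t = 0) :
    W.addAt s t * (1 - MvPowerSeries.C W.a₁ * W.thirdAt s t
      - MvPowerSeries.C W.a₃ * W.wAt (W.thirdAt s t)) = -W.thirdAt s t := by
  have hb := MvPowerSeries.hasSubst_pair hs ht
  have e := congrArg (MvPowerSeries.subst ![s, t]) W.formalGroupLaw_mul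
  have h0 := W.constantCoeff_thirdAt (σ := Fin 2) (s := MvPowerSeries.X 0)
    (t := MvPowerSeries.X 1) (by simp) (by simp)
  have e3 : W.formalThird.subst ![s, t] = W.thirdAt s t := by
    rw [formalThird_eq, W.thirdAt_subst (by simp) (by simp) hb, MvPowerSeries.subst_X hb,
      MvPowerSeries.subst_X hb]
    rfl
  have ew : (W.wAt W.formalThird).subst ![s, t] = W.wAt (W.thirdAt s t) := by
    rw [W.wAt_subst (by rwa [formalThird_eq]) hb, e3]
  rw [← MvPowerSeries.coe_substAlgHom hb] at e e3 ew
  simp only [map_sub, map_neg, map_mul, map_one, e3, ew] at e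
  simpa only [MvPowerSeries.coe_substAlgHom, MvPowerSeries.subst_C] using e

theorem constantCoeff_multSeries (n : ℕ) :
    PowerSeries.constantCoeff (LevelThree.multSeries W.formalGroupLaw n) = 0 := by
  induction n with
  | zero => simp [LevelThree.multSeries]
  | succ n ih => exact W.constantCoeff_addAt (σ := Unit) ih PowerSeries.constantCoeff_X

end Ring

end WeierstrassCurve

/-! ### Collinear triples of formal parameters -/

namespace WeierstrassCurve

/-- The points with parameters `s`, `t`, `u` are the three intersection points of the curve with
the line `w = l z + m`. -/
structure FormalCollinear {σ R : Type*} [CommRing R] (W : WeierstrassCurve R)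
    (s t u l m : MvPowerSeries σ R) : Prop where
  wAt_left : W.wAt s = l * s + m
  wAt_mid : W.wAt t = l * t + m
  wAt_right : W.wAt u = l * u + m
  -- Viète's relations for the cubic obtained by putting w = l z + m in the equation. They record
  -- multiplicities, so tangent lines need no separate treatment.
  sum_eq : s + t + u = -(MvPowerSeries.C W.a₁ * l + MvPowerSeries.C W.a₃ * l ^ 2)
  sum_mul_eq : s * t + s * u + t * u =
    MvPowerSeries.C W.a₁ * m + 2 * MvPowerSeries.C W.a₃ * l * m - l
  prod_eq : s * t * u = m - MvPowerSeries.C W.a₃ * m ^ 2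

namespace FormalCollinear

variable {σ R : Type*} [CommRing R] {W : WeierstrassCurve R} {s t u l m : MvPowerSeries σ R}

theorem rotate (h : W.FormalCollinear s t u l m) : W.FormalCollinear t u s l m :=
  ⟨h.wAt_mid, h.wAt_right, h.wAt_left, by rw [← h.sum_eq]; ring, by rw [← h.sum_mul_eq]; ring,
    by rw [← h.prod_eq]; ring⟩

end FormalCollinear

section Ring

variable {σ R : Type*} [CommRing R] [IsDomain R] (W : WeierstrassCurve R) [W.IsThreeTorsionForm]
  {s t : MvPowerSeries σ R}

/-- For s = t the relation (s - t) l = w(s) - w(t) does not determine l. The second Viète relation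
is therefore proved for the independent variables X 0 and X 1, whose difference can be cancelled,
and then specialized. -/
theorem formalCollinear (hs : MvPowerSeries.constantCoeff s = 0)
    (ht : MvPowerSeries.constantCoeff t = 0) :
    W.FormalCollinear s t (W.thirdAt s t) (W.slopeAt s t) (W.interceptAt s t) := by
  have h0 := W.constantCoeff_slopeAt hs ht
  have e1 : s + t + W.thirdAt s t =
      -(MvPowerSeries.C W.a₁ * W.slopeAt s t + MvPowerSeries.C W.a₃ * W.slopeAt s t ^ 2) := by
    rw [thirdAt]; ring
  have e2 : s * t + s * W.thirdAt s t + t * W.thirdAt s t =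
      MvPowerSeries.C W.a₁ * W.interceptAt s t +
        2 * MvPowerSeries.C W.a₃ * W.slopeAt s t * W.interceptAt s t - W.slopeAt s t := by
    have key : ∀ x y : MvPowerSeries (Fin 2) R, x = MvPowerSeries.X 0 → y = MvPowerSeries.X 1 →
        x * y + x * W.thirdAt x y + y * W.thirdAt x y =
          MvPowerSeries.C W.a₁ * W.interceptAt x y +
          2 * MvPowerSeries.C W.a₃ * W.slopeAt x y * W.interceptAt x y - W.slopeAt x y := by
      intro x y ex ey
      have hx : MvPowerSeries.constantCoeff x = 0 := by simp [ex]
      have hy : MvPowerSeries.constantCoeff y = 0 := by simp [ey]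
      have hne : x - y ≠ 0 := by
        rw [sub_ne_zero, ex, ey]
        intro h
        exact zero_ne_one ((MvPowerSeries.X_inj (R := R)).mp h)
      have hX := W.formalEquation_wAt hx
      have hY := W.formalEquation_wAt hy
      have hl := W.sub_mul_slopeAt hx hy
      unfold FormalEquation at hX hY
      rw [interceptAt, thirdAt]
      refine mul_left_cancel₀ hne ?_
      generalize W.wAt x = wx at *
      generalize W.wAt y = wy at *
      generalize W.slopeAt x y = l at *
      obtain rfl : wy = wx - (x - y) * l := by rw [hl]; ring
      linear_combination hX - hY
    have hb := MvPowerSeries.hasSubst_pair hs ht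
    have e := congrArg (MvPowerSeries.substAlgHom hb) (key _ _ rfl rfl)
    have e3 : MvPowerSeries.substAlgHom hb
        (W.thirdAt (MvPowerSeries.X 0) (MvPowerSeries.X 1)) = W.thirdAt s t := by
      rw [MvPowerSeries.coe_substAlgHom, W.thirdAt_subst (by simp) (by simp) hb,
        MvPowerSeries.subst_X hb, MvPowerSeries.subst_X hb]
      rfl
    have el : MvPowerSeries.substAlgHom hb
        (W.slopeAt (MvPowerSeries.X 0) (MvPowerSeries.X 1)) = W.slopeAt s t := by
      rw [MvPowerSeries.coe_substAlgHom, slopeAt, MvPowerSeries.subst_pair_X]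
    have ew : MvPowerSeries.substAlgHom hb (W.wAt (MvPowerSeries.X 0)) = W.wAt s := by
      rw [MvPowerSeries.coe_substAlgHom, W.wAt_subst (by simp) hb, MvPowerSeries.subst_X hb]
      rfl
    have eC : ∀ r, MvPowerSeries.substAlgHom hb (MvPowerSeries.C r) = MvPowerSeries.C r := by
      intro r
      rw [MvPowerSeries.coe_substAlgHom, MvPowerSeries.subst_C]
    simpa only [map_add, map_sub, map_mul, e3, el, ew, eC, interceptAt, map_ofNat,
      MvPowerSeries.substAlgHom_X, Matrix.cons_val_zero, Matrix.cons_val_one] using e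
  have hS := W.formalEquation_wAt hs
  have hl := W.sub_mul_slopeAt hs ht
  have e3 : s * t * W.thirdAt s t =
      W.interceptAt s t - MvPowerSeries.C W.a₃ * W.interceptAt s t ^ 2 := by
    unfold FormalEquation at hS
    have hw : W.wAt s = W.slopeAt s t * s + W.interceptAt s t := by rw [interceptAt]; ring
    rw [hw] at hS
    generalize W.interceptAt s t = m at *
    generalize W.slopeAt s t = l at *
    generalize W.thirdAt s t = u at *
    linear_combination s * e2 - s ^ 2 * e1 - hS
  refine ⟨?_, ?_, ?_, e1, e2, e3⟩
  · rw [interceptAt]; ring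
  · rw [interceptAt]; linear_combination hl
  -- Viète's relations say that l u + m solves the curve equation at u, so it is w(u) by uniqueness.
  · apply W.eq_wAt
    · unfold FormalEquation
      generalize W.interceptAt s t = m at *
      generalize W.slopeAt s t = l at *
      generalize W.thirdAt s t = u at *
      linear_combination -u ^ 2 * e1 + u * e2 - e3
    · exact W.constantCoeff_thirdAt hs ht
    · simp [interceptAt, hs, W.constantCoeff_wAt hs, W.constantCoeff_thirdAt hs ht]

end Ring

end WeierstrassCurve

/-! ### Collinear points and the addition relation on the affine curve -/

namespace WeierstrassCurve

open WeierstrassCurve.Affine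

section Affine

variable {F : Type*} [Field F] [DecidableEq F] {W : WeierstrassCurve F} [W.IsThreeTorsionForm]

/-- The symmetric functions of the x-coordinates also cover tangency: if x₁ = x₂, then E₁ and E₂
force L to be the tangent slope, and nonsingularity excludes that the second point is the negative
of the first. -/
theorem some_add_some_add_some_of_collinear {x₁ x₂ x₃ y₁ y₂ y₃ L N : F}
    (h₁ : W.toAffine.Nonsingular x₁ y₁) (h₂ : W.toAffine.Nonsingular x₂ y₂)
    (h₃ : W.toAffine.Nonsingular x₃ y₃) (e₁ : y₁ = L * x₁ + N) (e₂ : y₂ = L * x₂ + N)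
    (e₃ : y₃ = L * x₃ + N) (E₁ : x₁ + x₂ + x₃ = L ^ 2 + W.a₁ * L)
    (E₂ : x₁ * x₂ + x₁ * x₃ + x₂ * x₃ = -(2 * L * N + W.a₁ * N + W.a₃ * L)) :
    Point.some x₁ y₁ h₁ + Point.some x₂ y₂ h₂ + Point.some x₃ y₃ h₃ = 0 := by
  have tangent : x₁ = x₂ → (2 * y₁ + W.a₁ * x₁ + W.a₃) * L = 3 * x₁ ^ 2 - W.a₁ * y₁ := by
    rintro rfl
    rw [e₁]
    linear_combination E₂ - 2 * x₁ * E₁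
  have hxy : ¬(x₁ = x₂ ∧ y₁ = W.toAffine.negY x₂ y₂) := by
    rintro ⟨hx, hy⟩
    have hT := tangent hx
    subst hx
    have hyy : y₁ = y₂ := by rw [e₁, e₂]
    rw [← hyy, negY] at hy
    have h0 : 2 * y₁ + W.a₁ * x₁ + W.a₃ = 0 := by linear_combination hy
    rw [h0, zero_mul] at hT
    rw [nonsingular_iff] at h₁
    rcases h₁.2 with h | h
    · apply h
      simp only [IsThreeTorsionForm.a₂, IsThreeTorsionForm.a₄]
      linear_combination hT
    · apply h
      linear_combination h0
  have hslope : W.toAffine.slope x₁ x₂ y₁ y₂ = L := by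
    by_cases hx : x₁ = x₂
    · have hy : y₁ ≠ W.toAffine.negY x₂ y₂ := fun h => hxy ⟨hx, h⟩
      have hT := tangent hx
      rw [slope_of_Y_ne hx hy]
      subst hx
      have hyy : y₁ = y₂ := by rw [e₁, e₂]
      rw [← hyy, negY] at hy
      rw [negY, div_eq_iff]
      · simp only [IsThreeTorsionForm.a₂, IsThreeTorsionForm.a₄]
        linear_combination -hT
      · intro h
        exact hy (by linear_combination h)
    · rw [slope_of_X_ne hx, div_eq_iff (sub_ne_zero.mpr hx), e₁, e₂]
      ring
  have hX : W.toAffine.addX x₁ x₂ L = x₃ := by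
    simp only [addX, IsThreeTorsionForm.a₂]
    linear_combination -E₁
  rw [Point.add_some hxy, add_eq_zero_iff_eq_neg, Point.neg_some]
  rw [Point.some.injEq, hslope, addY, negAddY, hX]
  refine ⟨rfl, congrArg _ ?_⟩
  rw [e₁, e₃]
  ring

/-- Only the x-coordinates enter, so x(P + Q) and x(P - Q) are roots of the same quadratic; this is
the source of the parallelogram inequality for heights. -/
theorem addX_relation {x₁ x₂ x₃ y₁ y₂ y₃ : F}
    (h₁ : W.toAffine.Nonsingular x₁ y₁) (h₂ : W.toAffine.Nonsingular x₂ y₂)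
    (h₃ : W.toAffine.Nonsingular x₃ y₃)
    (h : Point.some x₁ y₁ h₁ + Point.some x₂ y₂ h₂ = Point.some x₃ y₃ h₃) :
    (x₁ - x₂) ^ 2 * x₃ ^ 2 - (2 * x₁ * x₂ * (x₁ + x₂) + W.b₄ * (x₁ + x₂) + W.b₂ * (x₁ * x₂)
      + W.b₆) * x₃ + ((x₁ * x₂) ^ 2 - W.b₄ * (x₁ * x₂) - W.b₆ * (x₁ + x₂)) = 0 := by
  have hxy : ¬(x₁ = x₂ ∧ y₁ = W.toAffine.negY x₂ y₂) := by
    rintro ⟨hx, hy⟩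
    rw [Point.add_of_Y_eq hx hy] at h
    exact Point.some_ne_zero _ h.symm
  rw [Point.add_some hxy, Point.some.injEq] at h
  have hp := addPolynomial_slope h₁.1 h₂.1 hxy
  rw [h.1, addPolynomial_eq] at hp
  generalize W.toAffine.slope x₁ x₂ y₁ y₂ = L at hp
  have c0 := congrArg (Polynomial.coeff · 0) hp
  have c1 := congrArg (Polynomial.coeff · 1) hp
  have c2 := congrArg (Polynomial.coeff · 2) hp
  have hc : -((Polynomial.X - Polynomial.C x₁) * (Polynomial.X - Polynomial.C x₂) *
      (Polynomial.X - Polynomial.C x₃)) = -Cubic.toPoly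
        ⟨1, -(x₁ + x₂ + x₃), x₁ * x₂ + x₁ * x₃ + x₂ * x₃, -(x₁ * x₂ * x₃)⟩ := by
    simp only [Cubic.toPoly, map_neg, map_add, map_mul, map_one]
    ring
  simp only [hc, Polynomial.coeff_neg, Cubic.coeff_eq_b, Cubic.coeff_eq_c,
    Cubic.coeff_eq_d, IsThreeTorsionForm.a₂, IsThreeTorsionForm.a₄, IsThreeTorsionForm.a₆,
    neg_inj] at c0 c1 c2
  simp only [b₂, b₄, b₆, IsThreeTorsionForm.a₂, IsThreeTorsionForm.a₄, IsThreeTorsionForm.a₆]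
  obtain ⟨N, rfl⟩ : ∃ N, y₁ = L * x₁ + N := ⟨y₁ - L * x₁, by ring⟩
  have E₁ : x₁ + x₂ + x₃ = L ^ 2 + W.a₁ * L := by linear_combination c2
  have E₂ : x₁ * x₂ + x₁ * x₃ + x₂ * x₃ = -(2 * L * N + W.a₁ * N + W.a₃ * L) := by
    linear_combination -c1
  have E₃ : x₁ * x₂ * x₃ = N ^ 2 + W.a₃ * N := by linear_combination c0
  -- With e₁, e₂, e₃ the elementary symmetric functions of the xᵢ, this is a quarter of (a₁ a₃ - 2
  -- e₂)² = (4 e₁ + a₁²)(4 e₃ + a₃²), both sides being ((2 L + a₁)(2 N + a₃))². Without the factor 4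
  -- it is also meaningful in characteristic 2.
  have key : (x₁ * x₂ + x₁ * x₃ + x₂ * x₃) ^ 2
      - W.a₁ * W.a₃ * (x₁ * x₂ + x₁ * x₃ + x₂ * x₃)
      - 4 * (x₁ + x₂ + x₃) * (x₁ * x₂ * x₃) - W.a₃ ^ 2 * (x₁ + x₂ + x₃)
      - W.a₁ ^ 2 * (x₁ * x₂ * x₃) = 0 := by
    rw [E₁, E₂, E₃]
    ring
  linear_combination key

end Affine

end WeierstrassCurve

/-! ### Formal parameters as points over a fraction field -/

namespace WeierstrassCurve

open WeierstrassCurve.Affine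

section FormalPoint

variable {σ k : Type*} [Field k] (W : WeierstrassCurve k)

/-- The embedding of the coefficients into the field of fractions of a power series ring. -/
def coeffHom (σ k : Type*) [Field k] : k →+* FractionRing (MvPowerSeries σ k) :=
  (algebraMap (MvPowerSeries σ k) _).comp MvPowerSeries.C

/-- The base change of `W` to the field of fractions of a power series ring. -/
abbrev fractionCurve (σ : Type*) : WeierstrassCurve (FractionRing (MvPowerSeries σ k)) :=
  W.map (coeffHom σ k)

variable [W.IsThreeTorsionForm] {s t u l m : MvPowerSeries σ k}

local notation "ι" => algebraMap (MvPowerSeries σ k) (FractionRing (MvPowerSeries σ k))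

theorem wAt_ne_zero (hs : MvPowerSeries.constantCoeff s = 0) (h : s ≠ 0) : W.wAt s ≠ 0 := by
  intro h0
  have := W.wAt_mul hs
  rw [h0, zero_mul] at this
  exact h (pow_eq_zero_iff (by norm_num) |>.mp this.symm)

theorem wAt_zero : W.wAt (0 : MvPowerSeries σ k) = 0 :=
  W.eq_wAt (by simp [FormalEquation]) (by simp) (by simp)

theorem algebraMap_ne_zero {a : MvPowerSeries σ k} (h : a ≠ 0) : ι a ≠ 0 := by
  rwa [Ne, FaithfulSMul.algebraMap_eq_zero_iff]

variable [W.IsElliptic]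

theorem nonsingular_formal (hs : MvPowerSeries.constantCoeff s = 0) (h : s ≠ 0) :
    (W.fractionCurve σ).toAffine.Nonsingular (ι s / ι (W.wAt s)) (-1 / ι (W.wAt s)) := by
  rw [← equation_iff_nonsingular, equation_iff]
  have hw := algebraMap_ne_zero (W.wAt_ne_zero hs h)
  have e := congrArg ι (W.formalEquation_wAt hs)
  simp only [map_add, map_mul, map_pow] at e
  simp only [map_a₁, map_a₃, IsThreeTorsionForm.a₂, IsThreeTorsionForm.a₄, IsThreeTorsionForm.a₆,
    coeffHom, RingHom.comp_apply]
  field_simp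
  linear_combination e

open Classical in
/-- The point of the curve with parameter `s`. -/
def formalPoint (s : MvPowerSeries σ k) (hs : MvPowerSeries.constantCoeff s = 0) :
    (W.fractionCurve σ).toAffine.Point :=
  if h : s = 0 then 0 else Point.some _ _ (W.nonsingular_formal hs h)

theorem formalPoint_zero : W.formalPoint (0 : MvPowerSeries σ k) (by simp) = 0 := by
  simp [formalPoint]

theorem formalPoint_of_ne_zero (hs : MvPowerSeries.constantCoeff s = 0) (h : s ≠ 0) :
    W.formalPoint s hs = Point.some _ _ (W.nonsingular_formal hs h) := by
  simp [formalPoint, h]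

theorem formalPoint_eq_zero_iff (hs : MvPowerSeries.constantCoeff s = 0) :
    W.formalPoint s hs = 0 ↔ s = 0 := by
  by_cases h : s = 0
  · subst h
    simp [formalPoint_zero]
  · simp [W.formalPoint_of_ne_zero hs h, h, Point.some_ne_zero]

/-- Injectivity is what carries identities between points back to identities between power series.
-/
theorem formalPoint_inj (hs : MvPowerSeries.constantCoeff s = 0)
    (ht : MvPowerSeries.constantCoeff t = 0) :
    W.formalPoint s hs = W.formalPoint t ht ↔ s = t := by
  refine ⟨fun h => ?_, by rintro rfl; rfl⟩
  by_cases h0 : s = 0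
  · subst h0
    rw [formalPoint_zero, eq_comm, formalPoint_eq_zero_iff] at h
    exact h.symm
  by_cases h1 : t = 0
  · subst h1
    rwa [formalPoint_zero, formalPoint_eq_zero_iff] at h
  rw [W.formalPoint_of_ne_zero hs h0, W.formalPoint_of_ne_zero ht h1, Point.some.injEq] at h
  have hw := algebraMap_ne_zero (W.wAt_ne_zero hs h0)
  have hw' := algebraMap_ne_zero (W.wAt_ne_zero ht h1)
  apply FaithfulSMul.algebraMap_injective _ (FractionRing (MvPowerSeries σ k))
  have e : ι (W.wAt s) = ι (W.wAt t) := by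
    have := h.2
    rw [div_eq_div_iff hw hw'] at this
    linear_combination this
  have := h.1
  rwa [e, div_left_inj' hw'] at this

theorem formalPoint_congr (hs : MvPowerSeries.constantCoeff s = 0) (h : s = t) :
    W.formalPoint s hs = W.formalPoint t (h ▸ hs) := by
  subst h; rfl

/-- If `t (1 - a₁ s - a₃ w(s)) = -s`, then `t` is the parameter of the negative of `s`. -/
theorem formalPoint_eq_neg (hs : MvPowerSeries.constantCoeff s = 0)
    (ht : MvPowerSeries.constantCoeff t = 0)
    (h : t * (1 - MvPowerSeries.C W.a₁ * s - MvPowerSeries.C W.a₃ * W.wAt s) = -s) :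
    W.formalPoint t ht = -W.formalPoint s hs := by
  have hu := W.isUnit_wAt hs
  by_cases h0 : s = 0
  · subst h0
    rw [neg_zero, hu.mul_left_eq_zero] at h
    subst h
    simp [formalPoint_zero]
  have h1 : t ≠ 0 := by
    rintro rfl
    rw [zero_mul, eq_comm, neg_eq_zero] at h
    exact h0 h
  -- Negation is (z, w) ↦ (-z / D, -w / D) with D = 1 - a₁ z - a₃ w; the second coordinate is
  -- identified by the uniqueness of w(t).
  have hwt : W.wAt t * (1 - MvPowerSeries.C W.a₁ * s - MvPowerSeries.C W.a₃ * W.wAt s)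
      = -W.wAt s := by
    obtain ⟨v, hv⟩ := hu.exists_right_inv
    have hc : MvPowerSeries.constantCoeff (-W.wAt s * v) = 0 := by
      simp [W.constantCoeff_wAt hs]
    have : W.wAt t = -W.wAt s * v := by
      refine W.eq_wAt ?_ ht hc
      have ht' : t = -s * v := by linear_combination v * h - t * hv
      have e := W.wAt_mul hs
      unfold FormalEquation
      rw [ht']
      generalize W.wAt s = w at *
      linear_combination (w * v ^ 2 + w * v) * hv - v ^ 3 * e
    rw [this]
    linear_combination -W.wAt s * hv
  rw [W.formalPoint_of_ne_zero hs h0, W.formalPoint_of_ne_zero ht h1, Point.neg_some,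
    Point.some.injEq, negY]
  have hw := algebraMap_ne_zero (W.wAt_ne_zero hs h0)
  have hw' := algebraMap_ne_zero (W.wAt_ne_zero ht h1)
  have hd := algebraMap_ne_zero hu.ne_zero
  have e1 := congrArg ι h
  have e2 := congrArg ι hwt
  rw [map_mul, map_neg] at e1 e2
  simp only [map_sub, map_one, map_mul] at hd e1 e2
  simp only [map_a₁, map_a₃, coeffHom, RingHom.comp_apply]
  constructor
  · rw [div_eq_div_iff hw' hw]
    refine mul_right_cancel₀ hd ?_
    linear_combination ι (W.wAt s) * e1 - ι s * e2
  · rw [div_eq_iff hw', ← mul_right_inj' hw]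
    field_simp
    linear_combination -e2

open Classical in
theorem FormalCollinear.formalPoint_add_eq_zero {W : WeierstrassCurve k} [W.IsThreeTorsionForm]
    [W.IsElliptic] (h : W.FormalCollinear s t u l m) (hs : MvPowerSeries.constantCoeff s = 0)
    (ht : MvPowerSeries.constantCoeff t = 0) (hu : MvPowerSeries.constantCoeff u = 0) :
    W.formalPoint s hs + W.formalPoint t ht + W.formalPoint u hu = 0 := by
  -- If one parameter is 0, then m = 0 and the line passes through O, so the other two points are
  -- opposite.
  have zero_case : ∀ {t u : MvPowerSeries σ k} (ht : MvPowerSeries.constantCoeff t = 0)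
      (hu : MvPowerSeries.constantCoeff u = 0), W.FormalCollinear 0 t u l m →
      W.formalPoint t ht + W.formalPoint u hu = 0 := by
    intro t u ht hu h
    rw [add_eq_zero_iff_eq_neg]
    have hm : m = 0 := by
      have := h.wAt_left
      rw [wAt_zero] at this
      linear_combination -this
    subst hm
    apply W.formalPoint_eq_neg
    have e1 := h.sum_eq
    have e2 := h.sum_mul_eq
    have e3 := h.wAt_right
    rw [e3]
    linear_combination e1 + (MvPowerSeries.C W.a₁ + MvPowerSeries.C W.a₃ * l) * (-e2)
  by_cases hs0 : s = 0
  · subst hs0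
    rw [formalPoint_zero, zero_add]
    exact zero_case ht hu h
  by_cases ht0 : t = 0
  · subst ht0
    rw [formalPoint_zero, add_zero, add_comm]
    exact zero_case hu hs h.rotate
  by_cases hu0 : u = 0
  · subst hu0
    rw [formalPoint_zero, add_zero]
    exact zero_case hs ht h.rotate.rotate
  have hm : m ≠ 0 := by
    rintro rfl
    have := h.prod_eq
    simp [hs0, ht0, hu0] at this
  rw [W.formalPoint_of_ne_zero hs hs0, W.formalPoint_of_ne_zero ht ht0,
    W.formalPoint_of_ne_zero hu hu0]
  have hws := algebraMap_ne_zero (W.wAt_ne_zero hs hs0)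
  have hwt := algebraMap_ne_zero (W.wAt_ne_zero ht ht0)
  have hwu := algebraMap_ne_zero (W.wAt_ne_zero hu hu0)
  have hm' := algebraMap_ne_zero hm
  have e1 := congrArg ι h.sum_eq
  have e2 := congrArg ι h.sum_mul_eq
  have e3 := congrArg ι h.prod_eq
  have f1 := congrArg ι h.wAt_left
  have f2 := congrArg ι h.wAt_mid
  have f3 := congrArg ι h.wAt_right
  simp only [map_add, map_sub, map_mul, map_neg, map_pow, map_ofNat] at e1 e2 e3 f1 f2 f3
  have hprod : ι (W.wAt s) * ι (W.wAt t) * ι (W.wAt u) = ι m ^ 3 := by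
    rw [f1, f2, f3]
    linear_combination ι l ^ 3 * e3 + ι l ^ 2 * ι m * e2 + ι l * ι m ^ 2 * e1
  have hnum₁ : ι s * ι (W.wAt t) * ι (W.wAt u) + ι t * ι (W.wAt s) * ι (W.wAt u)
      + ι u * ι (W.wAt s) * ι (W.wAt t) =
      ι l ^ 2 * ι m + ι (MvPowerSeries.C W.a₁) * ι l * ι m ^ 2 := by
    rw [f1, f2, f3]
    linear_combination 3 * ι l ^ 2 * e3 + 2 * ι l * ι m * e2 + ι m ^ 2 * e1
  have hnum₂ : ι s * ι t * ι (W.wAt u) + ι s * ι u * ι (W.wAt t) + ι t * ι u * ι (W.wAt s) =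
      2 * ι l * ι m - ι (MvPowerSeries.C W.a₃) * ι l * ι m ^ 2
        + ι (MvPowerSeries.C W.a₁) * ι m ^ 2 := by
    rw [f1, f2, f3]
    linear_combination 3 * ι l * e3 + ι m * e2
  -- Dividing w = l z + m by w, with x = z / w and y = -1 / w, gives y = (l / m) x - 1 / m.
  apply some_add_some_add_some_of_collinear (L := ι l / ι m) (N := -1 / ι m)
  · rw [f1] at hws ⊢
    field_simp
    ring
  · rw [f2] at hwt ⊢
    field_simp
    ring
  · rw [f3] at hwu ⊢
    field_simp
    ring
  · have h1 : ∀ a b c x y z : FractionRing (MvPowerSeries σ k), x ≠ 0 → y ≠ 0 → z ≠ 0 →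
        a / x + b / y + c / z = (a * y * z + b * x * z + c * x * y) / (x * y * z) := by
      intro a b c x y z hx hy hz
      field_simp
    rw [h1 _ _ _ _ _ _ hws hwt hwu, hprod, hnum₁]
    simp only [map_a₁, coeffHom, RingHom.comp_apply]
    field_simp
  · have h1 : ∀ a b c x y z : FractionRing (MvPowerSeries σ k), x ≠ 0 → y ≠ 0 → z ≠ 0 →
        a / x * (b / y) + a / x * (c / z) + b / y * (c / z) =
          (a * b * z + a * c * y + b * c * x) / (x * y * z) := by
      intro a b c x y z hx hy hz
      field_simp
    rw [h1 _ _ _ _ _ _ hws hwt hwu, hprod, hnum₂]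
    simp only [map_a₁, map_a₃, coeffHom, RingHom.comp_apply]
    field_simp
    ring

open Classical in
-- The points s, t and the third point of their chord sum to O, and F(s, t) is by construction the
-- negative of the third point.
theorem formalPoint_add (hs : MvPowerSeries.constantCoeff s = 0)
    (ht : MvPowerSeries.constantCoeff t = 0) :
    W.formalPoint s hs + W.formalPoint t ht =
      W.formalPoint (W.addAt s t) (W.constantCoeff_addAt hs ht) := by
  rw [W.formalPoint_eq_neg (W.constantCoeff_thirdAt hs ht) (W.constantCoeff_addAt hs ht)
    (W.addAt_mul hs ht), ← add_eq_zero_iff_eq_neg]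
  exact (W.formalCollinear hs ht).formalPoint_add_eq_zero hs ht (W.constantCoeff_thirdAt hs ht)

theorem addAt_zero (hs : MvPowerSeries.constantCoeff s = 0) : W.addAt s 0 = s := by
  classical
  rw [← W.formalPoint_inj (W.constantCoeff_addAt hs (by simp)) hs,
    ← W.formalPoint_add hs (by simp), formalPoint_zero, add_zero]

theorem addAt_comm (hs : MvPowerSeries.constantCoeff s = 0)
    (ht : MvPowerSeries.constantCoeff t = 0) : W.addAt s t = W.addAt t s := by
  classical
  rw [← W.formalPoint_inj (W.constantCoeff_addAt hs ht) (W.constantCoeff_addAt ht hs),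
    ← W.formalPoint_add hs ht, ← W.formalPoint_add ht hs, add_comm]

/-- The series `[n](s)`. -/
abbrev mulAt (n : ℕ) (s : MvPowerSeries σ k) : MvPowerSeries σ k :=
  (LevelThree.multSeries W.formalGroupLaw n).subst s

omit [W.IsElliptic] in
theorem constantCoeff_mulAt (n : ℕ) (hs : MvPowerSeries.constantCoeff s = 0) :
    MvPowerSeries.constantCoeff (W.mulAt n s) = 0 :=
  PowerSeries.constantCoeff_subst_eq_zero hs _ (W.constantCoeff_multSeries n)

omit [W.IsElliptic] in
theorem mulAt_succ (n : ℕ) (hs : MvPowerSeries.constantCoeff s = 0) :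
    W.mulAt (n + 1) s = W.addAt (W.mulAt n s) s := by
  rw [mulAt, LevelThree.multSeries, MvPowerSeries.subst_pair_powerSeries_subst
    (W.constantCoeff_multSeries n) PowerSeries.constantCoeff_X hs, PowerSeries.subst_X
    (PowerSeries.HasSubst.of_constantCoeff_zero hs)]

open Classical in
theorem formalPoint_mulAt (n : ℕ) (hs : MvPowerSeries.constantCoeff s = 0) :
    W.formalPoint (W.mulAt n s) (W.constantCoeff_mulAt n hs) = n • W.formalPoint s hs := by
  induction n with
  | zero =>
    rw [zero_nsmul, formalPoint_eq_zero_iff, mulAt, LevelThree.multSeries,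
      ← PowerSeries.coe_substAlgHom (PowerSeries.HasSubst.of_constantCoeff_zero hs), map_zero]
  | succ n ih =>
    rw [succ_nsmul, ← ih, W.formalPoint_add (W.constantCoeff_mulAt n hs) hs]
    exact W.formalPoint_congr _ (W.mulAt_succ n hs)

/-- Multiplication by `n` is an endomorphism of the formal group law. -/
theorem mulAt_addAt (n : ℕ) (hs : MvPowerSeries.constantCoeff s = 0)
    (ht : MvPowerSeries.constantCoeff t = 0) :
    W.mulAt n (W.addAt s t) = W.addAt (W.mulAt n s) (W.mulAt n t) := by
  classical
  have h1 := W.constantCoeff_mulAt n (W.constantCoeff_addAt hs ht)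
  have h2 := W.constantCoeff_addAt (W.constantCoeff_mulAt n hs) (W.constantCoeff_mulAt n ht)
  rw [← W.formalPoint_inj h1 h2, W.formalPoint_mulAt n (W.constantCoeff_addAt hs ht),
    ← W.formalPoint_add hs ht, ← W.formalPoint_add (W.constantCoeff_mulAt n hs)
    (W.constantCoeff_mulAt n ht), W.formalPoint_mulAt n hs, W.formalPoint_mulAt n ht, nsmul_add]

end FormalPoint

end WeierstrassCurve

/-! ### Linear terms of the formal group law and of multiplication by n -/

namespace MvPowerSeries

variable {σ R : Type*} [CommRing R]

theorem constantCoeff_subst_of_zero {τ : Type*} [Finite σ] {a : σ → MvPowerSeries τ R}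
    (ha : ∀ i, constantCoeff (a i) = 0) (h : MvPowerSeries σ R) :
    constantCoeff (h.subst a) = constantCoeff h := by
  have hb := hasSubst_of_constantCoeff_zero ha
  have e := constantCoeff_subst_eq_zero hb ha (f := h - C (constantCoeff h)) (by simp)
  rw [subst_sub hb, subst_C, map_sub, constantCoeff_C, sub_eq_zero] at e
  exact e

/-- The part of g free of X 1 is a series q(X 0), which survives the substitution X 1 = 0 unchanged
and so must vanish. -/
theorem X_one_dvd_of_subst_eq_zero {g : MvPowerSeries (Fin 2) R}
    (h : g.subst ![(X 0 : MvPowerSeries (Fin 2) R), 0] = 0) : X 1 ∣ g := by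
  have hb := hasSubst_pair (s := (X 0 : MvPowerSeries (Fin 2) R)) (t := 0) (by simp) (by simp)
  let q : PowerSeries R := PowerSeries.mk fun n => coeff (Finsupp.single 0 n) g
  have hd : (X 1 : MvPowerSeries (Fin 2) R) ∣ g - q.subst (X 0 : MvPowerSeries (Fin 2) R) := by
    rw [X_dvd_iff]
    intro m hm
    have hm' : m = Finsupp.single 0 (m 0) := by
      ext i; fin_cases i <;> simp [hm]
    rw [map_sub, PowerSeries.coeff_subst_single, if_pos hm', PowerSeries.coeff_mk, ← hm', sub_self]
  obtain ⟨r, hr⟩ := hd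
  have e := congrArg (subst ![(X 0 : MvPowerSeries (Fin 2) R), 0]) hr
  rw [subst_sub hb, h, subst_powerSeries_subst (by simp) hb, subst_mul hb, subst_X hb,
    subst_X hb] at e
  simp only [Matrix.cons_val_zero, Matrix.cons_val_one, zero_mul, zero_sub, neg_eq_zero] at e
  rw [e, sub_zero] at hr
  exact ⟨r, hr⟩

end MvPowerSeries

namespace WeierstrassCurve

section

variable {k : Type*} [Field k] (W : WeierstrassCurve k) [W.IsThreeTorsionForm] [W.IsElliptic]

/-- F(X 0, 0) = X 0 makes F - X 0 divisible by X 1; F(0, X 1) = X 1 then fixes the constant term of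
the cofactor. -/
theorem formalGroupLaw_eq_X_add : ∃ h : MvPowerSeries (Fin 2) k,
    MvPowerSeries.constantCoeff h = 1 ∧
      W.formalGroupLaw = MvPowerSeries.X 0 + MvPowerSeries.X 1 * h := by
  have h0 : MvPowerSeries.constantCoeff (MvPowerSeries.X 0 : MvPowerSeries (Fin 2) k) = 0 := by simp
  have h1 : MvPowerSeries.constantCoeff (MvPowerSeries.X 1 : MvPowerSeries (Fin 2) k) = 0 := by simp
  have hz : MvPowerSeries.constantCoeff (0 : MvPowerSeries (Fin 2) k) = 0 := by simp
  have hb := MvPowerSeries.hasSubst_pair h0 hz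
  have hb' := MvPowerSeries.hasSubst_pair hz h1
  obtain ⟨h, hh⟩ := MvPowerSeries.X_one_dvd_of_subst_eq_zero
    (g := W.formalGroupLaw - MvPowerSeries.X 0) (by
      rw [MvPowerSeries.subst_sub hb, MvPowerSeries.subst_X hb]
      exact sub_eq_zero.mpr (W.addAt_zero h0))
  have e : W.formalGroupLaw = MvPowerSeries.X 0 + MvPowerSeries.X 1 * h := by rw [← hh]; ring
  refine ⟨h, ?_, e⟩
  have e' := congrArg (MvPowerSeries.subst ![0, (MvPowerSeries.X 1 : MvPowerSeries (Fin 2) k)]) e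
  have e'' := W.addAt_comm hz h1
  rw [W.addAt_zero h1, addAt] at e''
  rw [e'', MvPowerSeries.subst_add hb', MvPowerSeries.subst_mul hb', MvPowerSeries.subst_X hb',
    MvPowerSeries.subst_X hb', Matrix.cons_val_zero, Matrix.cons_val_one, zero_add] at e'
  have hX : (MvPowerSeries.X 1 : MvPowerSeries (Fin 2) k) ≠ 0 := by
    intro h
    have := congrArg (MvPowerSeries.coeff (Finsupp.single 1 1)) h
    simp [MvPowerSeries.coeff_index_single_self_X] at this
  have h2 := mul_left_cancel₀ hX ((mul_one _).trans e')
  rw [← MvPowerSeries.constantCoeff_subst_of_zero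
    (a := ![0, (MvPowerSeries.X 1 : MvPowerSeries (Fin 2) k)])
    (fun i => by fin_cases i <;> simp) h, ← h2]
  simp

theorem coeff_one_multSeries (n : ℕ) :
    PowerSeries.coeff 1 (LevelThree.multSeries W.formalGroupLaw n) = n := by
  induction n with
  | zero => simp [LevelThree.multSeries]
  | succ n ih =>
    obtain ⟨h, hh, e⟩ := W.formalGroupLaw_eq_X_add
    have hf := W.constantCoeff_multSeries n
    have hX : PowerSeries.constantCoeff (PowerSeries.X : PowerSeries k) = 0 :=
      PowerSeries.constantCoeff_X
    have hb := MvPowerSeries.hasSubst_pair (σ := Unit) hf hX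
    have e' : LevelThree.multSeries W.formalGroupLaw (n + 1) =
        LevelThree.multSeries W.formalGroupLaw n + PowerSeries.X *
          h.subst ![LevelThree.multSeries W.formalGroupLaw n, PowerSeries.X] := by
      have := congrArg (MvPowerSeries.subst
        ![LevelThree.multSeries W.formalGroupLaw n, PowerSeries.X]) e
      rwa [MvPowerSeries.subst_add hb, MvPowerSeries.subst_mul hb, MvPowerSeries.subst_X hb,
        MvPowerSeries.subst_X hb] at this
    have hc : PowerSeries.constantCoeff (h.subst
        ![LevelThree.multSeries W.formalGroupLaw n, PowerSeries.X] : PowerSeries k) = 1 := by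
      rw [← hh]
      exact MvPowerSeries.constantCoeff_subst_of_zero (fun i => by fin_cases i <;> simpa) h
    rw [e', map_add, ih, show (1 : ℕ) = 0 + 1 from rfl, PowerSeries.coeff_succ_X_mul,
      PowerSeries.coeff_zero_eq_constantCoeff_apply, hc]
    push_cast
    rfl

end

end WeierstrassCurve

/-! ### Endomorphisms of formal group laws in characteristic p -/

namespace PowerSeries

/-- An endomorphism `g(z^q)` of a formal group law in characteristic `p`, where `q` is a power
of `p`, satisfies `g' = 0` as soon as `g'(0) = 0`. -/
theorem natCast_mul_coeff_eq_zero_of_endomorphism {k : Type*} [Field k] (p : ℕ) [Fact p.Prime]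
    [CharP k p] (j : ℕ) {F h : MvPowerSeries (Fin 2) k} {f g : PowerSeries k}
    (hF : F = MvPowerSeries.X 0 + MvPowerSeries.X 1 * h)
    (hh : MvPowerSeries.constantCoeff h = 1) (hfg : f = g.subst (X ^ p ^ j : PowerSeries k))
    (hg₀ : coeff 0 g = 0) (hg₁ : coeff 1 g = 0)
    (hf : f.subst F = F.subst ![f.subst (MvPowerSeries.X 0 : MvPowerSeries (Fin 2) k),
      f.subst (MvPowerSeries.X 1 : MvPowerSeries (Fin 2) k)]) (n : ℕ) :
    ((n : k) + 1) * coeff (n + 1) g = 0 := by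
  have hp : p.Prime := Fact.out
  set q := p ^ j with hq
  have hq0 : q ≠ 0 := (pow_pos hp.pos j).ne'
  have hXq : constantCoeff (X ^ q : PowerSeries k) = 0 := by simp [hq0]
  have hF0 : MvPowerSeries.constantCoeff F = 0 := by simp [hF]
  have hX0 : MvPowerSeries.constantCoeff (MvPowerSeries.X 0 : MvPowerSeries (Fin 2) k) = 0 := by
    simp
  have hX1 : MvPowerSeries.constantCoeff (MvPowerSeries.X 1 : MvPowerSeries (Fin 2) k) = 0 := by
    simp
  have hsub : ∀ {s : MvPowerSeries (Fin 2) k}, MvPowerSeries.constantCoeff s = 0 →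
      f.subst s = g.subst (s ^ q) := by
    intro s hs
    have hs' := HasSubst.of_constantCoeff_zero hs
    rw [hfg, subst_comp_subst_apply (HasSubst.of_constantCoeff_zero hXq) hs', subst_pow hs',
      subst_X hs']
  have hpow : ∀ {s : MvPowerSeries (Fin 2) k}, MvPowerSeries.constantCoeff s = 0 →
      MvPowerSeries.constantCoeff (s ^ q) = 0 := by
    intro s hs
    simp [hs, hq0]
  have hf0 : constantCoeff f = 0 := by
    rw [hfg, constantCoeff_subst_X_pow hq0, ← coeff_zero_eq_constantCoeff_apply, hg₀, map_zero]
  obtain ⟨g₂, hg₂⟩ : X ^ 2 ∣ g := by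
    rw [X_pow_dvd_iff]
    intro m hm
    interval_cases m <;> assumption
  have hfX1 : f.subst (MvPowerSeries.X 1 : MvPowerSeries (Fin 2) k) =
      (MvPowerSeries.X 1 ^ q) ^ 2 * g₂.subst (MvPowerSeries.X 1 ^ q) := by
    have := HasSubst.of_constantCoeff_zero (hpow hX1)
    rw [hsub hX1, hg₂, subst_mul this, subst_pow this, subst_X this]
  have hb := MvPowerSeries.hasSubst_pair
    (constantCoeff_subst_eq_zero hX0 f hf0) (constantCoeff_subst_eq_zero hX1 f hf0)
  -- Since f(F) = F(f(X 0), f(X 1)) and F = X 0 + X 1 h, the difference f(F) - f(X 0) is a multiple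
  -- of f(X 1), hence of X 1 ^ (2 q).
  obtain ⟨r, hr⟩ : ∃ r, f.subst F - f.subst (MvPowerSeries.X 0 : MvPowerSeries (Fin 2) k) =
      f.subst (MvPowerSeries.X 1 : MvPowerSeries (Fin 2) k) * r := by
    refine ⟨h.subst ![f.subst (MvPowerSeries.X 0 : MvPowerSeries (Fin 2) k),
      f.subst (MvPowerSeries.X 1 : MvPowerSeries (Fin 2) k)], ?_⟩
    conv_lhs => rw [hf, hF]
    rw [MvPowerSeries.subst_add hb, MvPowerSeries.subst_mul hb, MvPowerSeries.subst_X hb,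
        MvPowerSeries.subst_X hb]
    simp
  have hS := sub_mul_divDiff_subst g (hpow hF0) (hpow hX0)
  rw [← hsub hF0, ← hsub hX0, hr, hfX1] at hS
  have : CharP (MvPowerSeries (Fin 2) k) p :=
    charP_of_injective_ringHom (f := MvPowerSeries.C) MvPowerSeries.C_injective p
  -- The q-th power map is additive, so F ^ q - X 0 ^ q is X 1 ^ q times a unit. Cancelling it
  -- leaves the divided difference of g still divisible by X 1 ^ q.
  have hFX : F ^ q - MvPowerSeries.X 0 ^ q = MvPowerSeries.X 1 ^ q * h ^ q := by
    rw [hq, ← sub_pow_char_pow, hF, ← mul_pow]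
    congr 1
    ring
  have hXne : (MvPowerSeries.X 1 : MvPowerSeries (Fin 2) k) ≠ 0 := by
    intro h
    have := congrArg (MvPowerSeries.coeff (Finsupp.single 1 1)) h
    simp [MvPowerSeries.coeff_index_single_self_X] at this
  obtain ⟨v, hv⟩ := ((MvPowerSeries.constantCoeff_eq_one_isUnit hh).pow q).exists_left_inv
  have hS' : (divDiff g).subst ![F ^ q, MvPowerSeries.X 0 ^ q] =
      MvPowerSeries.X 1 ^ q * (g₂.subst (MvPowerSeries.X 1 ^ q) * r * v) := by
    rw [hFX] at hS
    have := mul_left_cancel₀ (pow_ne_zero q hXne) ((mul_assoc _ _ _).symm.trans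
      (hS.trans (show _ = MvPowerSeries.X 1 ^ q *
        (MvPowerSeries.X 1 ^ q * (g₂.subst (MvPowerSeries.X 1 ^ q) * r)) by ring)))
    linear_combination v * this - (divDiff g).subst ![F ^ q, MvPowerSeries.X 0 ^ q] * hv
  have hX : constantCoeff (X : PowerSeries k) = 0 := constantCoeff_X
  have hz : constantCoeff (0 : PowerSeries k) = 0 := map_zero _
  have hc := MvPowerSeries.hasSubst_pair (σ := Unit) hX hz
  -- At X 1 = 0 both arguments of the divided difference become X ^ q, so g'(X ^ q) = 0.
  have e := congrArg (MvPowerSeries.subst ![(X : PowerSeries k), 0]) hS'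
  rw [MvPowerSeries.subst_subst_pair (hpow hF0) (hpow hX0) hc, MvPowerSeries.subst_pow hc,
    MvPowerSeries.subst_pow hc, MvPowerSeries.subst_mul hc, MvPowerSeries.subst_pow hc,
    hF, MvPowerSeries.subst_add hc, MvPowerSeries.subst_mul hc, MvPowerSeries.subst_X hc,
    MvPowerSeries.subst_X hc] at e
  simp only [Matrix.cons_val_zero, Matrix.cons_val_one, zero_mul, add_zero, zero_pow hq0] at e
  have e2 := MvPowerSeries.subst_pair_powerSeries_subst hX hX (s := (X ^ q : PowerSeries k)) hXq
    (divDiff g)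
  rw [subst_X (HasSubst.of_constantCoeff_zero hXq), e] at e2
  have e3 := congrArg (coeff (q * n)) e2
  rw [coeff_subst_X_pow hq0, if_pos (dvd_mul_right q n), Nat.mul_div_cancel_left n hq0.pos,
    coeff_divDiff_subst_self, Algebra.algebraMap_self_apply] at e3
  rw [e3]
  rfl

end PowerSeries

namespace WeierstrassCurve

variable {k : Type*} [Field k] (W : WeierstrassCurve k) [W.IsThreeTorsionForm] [W.IsElliptic]

/-- If the Hasse invariant vanishes, then `[p](z)` is a power series in `z ^ (p ^ 2)`. -/
theorem coeff_multSeries_eq_zero_of_hasseInvariant_eq_zero (p : ℕ) [Fact p.Prime] [CharP k p]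
    (hv : PowerSeries.coeff p (LevelThree.multSeries W.formalGroupLaw p) = 0) {m : ℕ}
    (hm : ¬ p ^ 2 ∣ m) : PowerSeries.coeff m (LevelThree.multSeries W.formalGroupLaw p) = 0 := by
  have hp : p.Prime := Fact.out
  obtain ⟨h, hh, hF⟩ := W.formalGroupLaw_eq_X_add
  set f := LevelThree.multSeries W.formalGroupLaw p with hf_def
  have hf0 : PowerSeries.coeff 0 f = 0 := by
    simpa using W.constantCoeff_multSeries p
  have hX0 : MvPowerSeries.constantCoeff (MvPowerSeries.X 0 : MvPowerSeries (Fin 2) k) = 0 := by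
    simp
  have hX1 : MvPowerSeries.constantCoeff (MvPowerSeries.X 1 : MvPowerSeries (Fin 2) k) = 0 := by
    simp
  have hendo := W.mulAt_addAt p hX0 hX1
  rw [addAt, MvPowerSeries.subst_pair_X] at hendo
  -- With q = 1: the derivative of [p] at 0 is p = 0, so [p] is a series in z ^ p.
  have step₁ : ∀ m, ¬ p ∣ m → PowerSeries.coeff m f = 0 := by
    intro m hm
    rcases m with _ | m
    · exact hf0
    have := PowerSeries.natCast_mul_coeff_eq_zero_of_endomorphism p 0 hF hh (f := f) (g := f)
      (by simp) hf0 (by rw [W.coeff_one_multSeries, CharP.cast_eq_zero]) hendo m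
    rcases mul_eq_zero.mp this with h | h
    · exact absurd ((CharP.cast_eq_zero_iff k p (m + 1)).mp (by exact_mod_cast h)) hm
    · exact h
  by_cases hpm : p ∣ m
  swap
  · exact step₁ m hpm
  -- With q = p: in [p](z) = g(z ^ p) the derivative g'(0) is the Hasse invariant, so g is again a
  -- series in z ^ p.
  let g : PowerSeries k := PowerSeries.mk fun n => PowerSeries.coeff (p * n) f
  have hfg : f = g.subst (PowerSeries.X ^ p ^ 1 : PowerSeries k) := by
    ext n
    rw [pow_one, PowerSeries.coeff_subst_X_pow hp.ne_zero]
    split_ifs with hn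
    · rw [PowerSeries.coeff_mk, Nat.mul_div_cancel' hn]
      rfl
    · exact step₁ n hn
  obtain ⟨l, rfl⟩ := hpm
  rcases l with _ | l
  · exact hf0
  have := PowerSeries.natCast_mul_coeff_eq_zero_of_endomorphism p 1 hF hh (f := f) (g := g)
    hfg (by simp [g, hf0]) (by simp [g, hv]) hendo l
  rcases mul_eq_zero.mp this with h | h
  · refine absurd ?_ hm
    rw [pow_two]
    exact mul_dvd_mul_left p ((CharP.cast_eq_zero_iff k p (l + 1)).mp (by exact_mod_cast h))
  · simpa [g] using h

end WeierstrassCurve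

/-! ### Heights of pairs of polynomials -/

namespace Polynomial

variable {k : Type*} [Field k] {a b c d : k[X]} {m n N : ℕ}

/-- The pair `(a, b)` has height `m`: this is the maximum of the two degrees. -/
structure PairHeight (a b : k[X]) (m : ℕ) : Prop where
  left_le : a.natDegree ≤ m
  right_le : b.natDegree ≤ m
  coeff_ne_zero : a.coeff m ≠ 0 ∨ b.coeff m ≠ 0

theorem pairHeight_max (hb : b ≠ 0) : PairHeight a b (max a.natDegree b.natDegree) := by
  refine ⟨le_max_left _ _, le_max_right _ _, ?_⟩
  rcases le_total a.natDegree b.natDegree with h | h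
  · right
    rw [max_eq_right h, coeff_natDegree]
    exact leadingCoeff_ne_zero.mpr hb
  · rw [max_eq_left h]
    by_cases ha : a = 0
    · right
      subst ha
      rw [natDegree_zero] at h ⊢
      rw [← Nat.le_zero.mp h, coeff_natDegree]
      exact leadingCoeff_ne_zero.mpr hb
    · left
      exact leadingCoeff_ne_zero.mpr ha

/-- The Gauss lemma at infinity. -/
theorem PairHeight.add_le (h : PairHeight a b m) (h' : PairHeight c d n)
    (h₁ : (b * d).natDegree ≤ N) (h₂ : (a * d + b * c).natDegree ≤ N)
    (h₃ : (a * c).natDegree ≤ N) : m + n ≤ N := by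
  by_contra! hlt
  -- In degree m + n the three coefficients are, up to sign, those of the product of the linear
  -- forms b_m T - a_m and d_n T - c_n. Both forms are nonzero, so the coefficients cannot all
  -- vanish.
  have e₁ := coeff_eq_zero_of_natDegree_lt (h₁.trans_lt hlt)
  have e₂ := coeff_eq_zero_of_natDegree_lt (h₂.trans_lt hlt)
  have e₃ := coeff_eq_zero_of_natDegree_lt (h₃.trans_lt hlt)
  rw [coeff_add] at e₂
  rw [coeff_mul_add_eq_of_natDegree_le h.right_le h'.right_le] at e₁
  rw [coeff_mul_add_eq_of_natDegree_le h.left_le h'.left_le] at e₃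
  rw [coeff_mul_add_eq_of_natDegree_le h.left_le h'.right_le,
    coeff_mul_add_eq_of_natDegree_le h.right_le h'.left_le] at e₂
  have hc := h.coeff_ne_zero
  have hc' := h'.coeff_ne_zero
  rcases mul_eq_zero.mp e₁ with h | h <;> rcases mul_eq_zero.mp e₃ with h' | h' <;>
    simp_all

theorem exists_isCoprime_reduction (c : k[X]) (hd : d ≠ 0) : ∃ g c' d' : k[X], g ≠ 0 ∧
    c = g * c' ∧ d = g * d' ∧ IsCoprime c' d' := by
  classical
  have hg : EuclideanDomain.gcd c d ≠ 0 := by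
    rw [Ne, EuclideanDomain.gcd_eq_zero_iff]
    exact fun h => hd h.2
  have e := EuclideanDomain.gcd_eq_gcd_ab c d
  obtain ⟨c', hc⟩ := EuclideanDomain.gcd_dvd_left c d
  obtain ⟨d', hd⟩ := EuclideanDomain.gcd_dvd_right c d
  refine ⟨EuclideanDomain.gcd c d, c', d', hg, hc, hd, EuclideanDomain.gcdA c d,
    EuclideanDomain.gcdB c d, mul_left_cancel₀ hg ?_⟩
  linear_combination -e - EuclideanDomain.gcdA c d * hc - EuclideanDomain.gcdB c d * hd

/-- A binary quadratic form with a root factors over the base ring. -/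
theorem exists_linear_cofactor {A B C : k[X]} (h : IsCoprime a b)
    (hr : A * a ^ 2 - B * a * b + C * b ^ 2 = 0) :
    ∃ c d : k[X], b * d = A ∧ a * d + b * c = B ∧ a * c = C := by
  obtain ⟨u, v, huv⟩ := h
  -- The witnesses are c and d multiplied by (u a + v b)² = 1 and rewritten with a² c = a C, a b c =
  -- b C, b² c = b B - a A and a² d = a B - b C, a b d = a A, b² d = b A.
  refine ⟨v ^ 2 * (b * B - a * A) + 2 * u * v * b * C + u ^ 2 * a * C,
    u ^ 2 * (a * B - b * C) + 2 * u * v * a * A + v ^ 2 * b * A, ?_, ?_, ?_⟩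
  · linear_combination -u ^ 2 * hr + A * (u * a + v * b + 1) * huv
  · linear_combination B * (u * a + v * b + 1) * huv - 2 * u * v * (-hr)
  · linear_combination -v ^ 2 * hr + C * (u * a + v * b + 1) * huv

theorem natDegree_le_of_eq_mul {g : k[X]} (hg : g ≠ 0) (h : c = g * a) :
    a.natDegree ≤ c.natDegree := by
  by_cases ha : a = 0
  · simp [ha]
  · rw [h, natDegree_mul hg ha]
    omega

end Polynomial

/-! ### Heights of the x-coordinates of multiples of a generic point -/

namespace WeierstrassCurve

open WeierstrassCurve.Affine

variable {k K : Type*} [Field k] [Field K] (W : WeierstrassCurve k) (φ : k →+* K) (x₀ : K)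

/-- The `x`-coordinate of the affine point `Q` is the reduced fraction `a / b`, evaluated at `x₀`
and of height `m`. -/
structure XRep (Q : (W.map φ).toAffine.Point) (x : K) (a b : k[X]) (m : ℕ) : Prop where
  eq_some : ∃ (y : K) (h : (W.map φ).toAffine.Nonsingular x y), Q = Point.some x y h
  eval_eq : b.eval₂ φ x₀ * x = a.eval₂ φ x₀
  isCoprime : IsCoprime a b
  height : Polynomial.PairHeight a b m

variable {W φ x₀}

/-- Cancelling common factors. -/
theorem exists_xRep_of_eval_eq (hφ : Function.Injective (Polynomial.eval₂ φ x₀))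
    {x y : K} (h : (W.map φ).toAffine.Nonsingular x y) {c d : k[X]} (hd : d ≠ 0)
    (e : d.eval₂ φ x₀ * x = c.eval₂ φ x₀) :
    ∃ c' d' g : k[X], ∃ m, c = g * c' ∧ d = g * d' ∧
      XRep W φ x₀ (Point.some x y h) x c' d' m ∧ m ≤ max c.natDegree d.natDegree := by
  obtain ⟨g, c', d', hg, hc, hd', hcop⟩ := Polynomial.exists_isCoprime_reduction c hd
  have hd0 : d' ≠ 0 := by
    rintro rfl
    exact hd (by rw [hd', mul_zero])
  refine ⟨c', d', g, _, hc, hd', ⟨⟨y, h, rfl⟩, ?_, hcop, Polynomial.pairHeight_max hd0⟩,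
    max_le_max (Polynomial.natDegree_le_of_eq_mul hg hc)
      (Polynomial.natDegree_le_of_eq_mul hg hd')⟩
  have hg' : g.eval₂ φ x₀ ≠ 0 := by
    intro h0
    exact hg (hφ (by rw [h0, Polynomial.eval₂_zero]))
  rw [hc, hd', Polynomial.eval₂_mul, Polynomial.eval₂_mul] at e
  refine mul_left_cancel₀ hg' ?_
  linear_combination e

theorem XRep.right_ne_zero {Q : (W.map φ).toAffine.Point} {x : K} {a b : k[X]} {m : ℕ}
    (hφ : Function.Injective (Polynomial.eval₂ φ x₀)) (h : XRep W φ x₀ Q x a b m) : b ≠ 0 := by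
  rintro rfl
  have e := h.eval_eq
  rw [Polynomial.eval₂_zero, zero_mul] at e
  have ha : a = 0 := hφ (by rw [← e, Polynomial.eval₂_zero])
  subst ha
  exact not_isCoprime_zero_zero h.isCoprime

/-- The reduction at `x = 0`, where the curve has a point of order three: the fraction `a / b`
vanishes there when `3 ∤ n` and has a pole when `3 ∣ n`. -/
def ThreeTorsionPattern (n : ℕ) (a b : k[X]) : Prop :=
  (n % 3 = 0 → b.eval 0 = 0) ∧ (n % 3 ≠ 0 → a.eval 0 = 0)

theorem XRep.eval_zero_ne {Q : (W.map φ).toAffine.Point} {x : K} {a b : k[X]} {m : ℕ}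
    (h : XRep W φ x₀ Q x a b m) : a.eval 0 ≠ 0 ∨ b.eval 0 ≠ 0 := by
  obtain ⟨u, v, huv⟩ := h.isCoprime
  by_contra! h0
  have := congrArg (Polynomial.eval 0) huv
  simp [h0.1, h0.2] at this

/-- The coefficient of `T²` in the quadratic with roots `x(P + Q)` and `x(P - Q)`. -/
def addSubA (X Z : k[X]) : k[X] := (X - Polynomial.X * Z) ^ 2

/-- Minus the coefficient of `T` in the quadratic with roots `x(P + Q)` and `x(P - Q)`. -/
def addSubB (W : WeierstrassCurve k) (X Z : k[X]) : k[X] :=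
  2 * Polynomial.X * X * (X + Polynomial.X * Z)
    + Polynomial.C W.b₄ * ((X + Polynomial.X * Z) * Z)
    + Polynomial.C W.b₂ * (Polynomial.X * X * Z) + Polynomial.C W.b₆ * Z ^ 2

/-- The constant coefficient in the quadratic with roots `x(P + Q)` and `x(P - Q)`. -/
def addSubC (W : WeierstrassCurve k) (X Z : k[X]) : k[X] :=
  Polynomial.X ^ 2 * X ^ 2 - Polynomial.C W.b₄ * (Polynomial.X * X * Z)
    - Polynomial.C W.b₆ * ((X + Polynomial.X * Z) * Z)

section degree

variable {X Z : k[X]} {M : ℕ}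

theorem natDegree_addSubA_le (hX : X.natDegree ≤ M) (hZ : Z.natDegree ≤ M) :
    (addSubA X Z).natDegree ≤ 2 * M + 2 := by
  have h1 := Polynomial.natDegree_X_le (R := k)
  rw [addSubA]
  compute_degree
  omega

theorem natDegree_addSubB_le (hX : X.natDegree ≤ M) (hZ : Z.natDegree ≤ M) :
    (addSubB W X Z).natDegree ≤ 2 * M + 2 := by
  rw [addSubB]
  compute_degree
  omega

theorem natDegree_addSubC_le (hX : X.natDegree ≤ M) (hZ : Z.natDegree ≤ M) :
    (addSubC W X Z).natDegree ≤ 2 * M + 2 := by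
  rw [addSubC]
  compute_degree
  omega

end degree

end WeierstrassCurve

namespace WeierstrassCurve

open WeierstrassCurve.Affine

variable {k K : Type*} [Field k] [Field K] {W : WeierstrassCurve k} {φ : k →+* K} {x₀ : K}

theorem eval₂_addSubA {X Z : k[X]} {x : K} (h : Z.eval₂ φ x₀ * x = X.eval₂ φ x₀) :
    (addSubA X Z).eval₂ φ x₀ = Z.eval₂ φ x₀ ^ 2 * (x - x₀) ^ 2 := by
  simp only [addSubA, Polynomial.eval₂_pow, Polynomial.eval₂_sub, Polynomial.eval₂_mul,
    Polynomial.eval₂_X, ← h]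
  ring

theorem eval₂_addSubB {X Z : k[X]} {x : K} (h : Z.eval₂ φ x₀ * x = X.eval₂ φ x₀) :
    (addSubB W X Z).eval₂ φ x₀ = Z.eval₂ φ x₀ ^ 2 * (2 * x * x₀ * (x + x₀) + φ W.b₄ * (x + x₀)
      + φ W.b₂ * (x * x₀) + φ W.b₆) := by
  simp only [addSubB, Polynomial.eval₂_pow, Polynomial.eval₂_add, Polynomial.eval₂_mul,
    Polynomial.eval₂_X, Polynomial.eval₂_C, Polynomial.eval₂_ofNat, ← h]
  ring

theorem eval₂_addSubC {X Z : k[X]} {x : K} (h : Z.eval₂ φ x₀ * x = X.eval₂ φ x₀) :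
    (addSubC W X Z).eval₂ φ x₀ = Z.eval₂ φ x₀ ^ 2 * ((x * x₀) ^ 2 - φ W.b₄ * (x * x₀)
      - φ W.b₆ * (x + x₀)) := by
  simp only [addSubC, Polynomial.eval₂_pow, Polynomial.eval₂_sub, Polynomial.eval₂_add,
    Polynomial.eval₂_mul, Polynomial.eval₂_X, Polynomial.eval₂_C, ← h]
  ring

/-- The behaviour of the cofactors of the parallelogram relation at the point of order three. -/
theorem pattern_step {n : ℕ} {a b X Z c d : k[X]} (h6 : W.b₆ ≠ 0)
    (hab : ThreeTorsionPattern n a b) (hXZ : ThreeTorsionPattern (n + 1) X Z)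
    (hab₀ : a.eval 0 ≠ 0 ∨ b.eval 0 ≠ 0) (hXZ₀ : X.eval 0 ≠ 0 ∨ Z.eval 0 ≠ 0)
    (hA : b * d = addSubA X Z) (hB : a * d + b * c = addSubB W X Z) (hC : a * c = addSubC W X Z) :
    ((n + 2) % 3 = 0 → d.eval 0 = 0 ∧ c.eval 0 ≠ 0) ∧
      ((n + 2) % 3 ≠ 0 → c.eval 0 = 0 ∧ d.eval 0 ≠ 0) := by
  have eA := congrArg (Polynomial.eval 0) hA
  have eB := congrArg (Polynomial.eval 0) hB
  have eC := congrArg (Polynomial.eval 0) hC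
  simp only [addSubA, addSubB, addSubC, Polynomial.eval_mul, Polynomial.eval_add,
    Polynomial.eval_sub, Polynomial.eval_pow, Polynomial.eval_X, Polynomial.eval_C, zero_mul,
    mul_zero, sub_zero, add_zero, zero_add, zero_pow two_ne_zero, zero_sub] at eA eB eC
  obtain ⟨h1, h2⟩ := hab
  obtain ⟨h3, h4⟩ := hXZ
  generalize a.eval 0 = a at *
  generalize b.eval 0 = b at *
  generalize c.eval 0 = c at *
  generalize d.eval 0 = d at *
  generalize X.eval 0 = X at *
  generalize Z.eval 0 = Z at *
  -- At x = 0 the relations read b d = X², a d + b c = b₄ X Z + b₆ Z² and a c = -b₆ X Z. In each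
  -- residue class one of a, b and one of X, Z vanish.
  have hn : n % 3 = 0 ∨ n % 3 = 1 ∨ n % 3 = 2 := by omega
  rcases hn with hn | hn | hn
  · have hb := h1 hn
    have hX := h4 (by omega)
    subst hb hX
    have ha : a ≠ 0 := by simpa using hab₀
    have hZ : Z ≠ 0 := by simpa using hXZ₀
    simp only [zero_mul, mul_zero, neg_zero, add_zero, zero_add] at eB eC
    refine ⟨fun h => by omega, fun _ => ⟨(mul_eq_zero.mp eC).resolve_left ha, ?_⟩⟩
    rintro rfl
    rw [mul_zero, eq_comm] at eB
    exact mul_ne_zero h6 (pow_ne_zero 2 hZ) eB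
  · have ha := h2 (by omega)
    have hX := h4 (by omega)
    subst ha hX
    have hb : b ≠ 0 := by simpa using hab₀
    have hZ : Z ≠ 0 := by simpa using hXZ₀
    simp only [zero_mul, mul_zero, zero_add, zero_pow two_ne_zero] at eA eB
    refine ⟨fun _ => ⟨(mul_eq_zero.mp eA).resolve_left hb, ?_⟩, fun h => by omega⟩
    rintro rfl
    rw [mul_zero, eq_comm] at eB
    exact mul_ne_zero h6 (pow_ne_zero 2 hZ) eB
  · have ha := h2 (by omega)
    have hZ := h3 (by omega)
    subst ha hZ
    have hb : b ≠ 0 := by simpa using hab₀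
    have hX : X ≠ 0 := by simpa using hXZ₀
    simp only [zero_mul, mul_zero, zero_add, zero_pow two_ne_zero] at eB
    refine ⟨fun h => by omega, fun _ => ⟨(mul_eq_zero.mp eB).resolve_left hb, ?_⟩⟩
    rintro rfl
    rw [mul_zero, eq_comm] at eA
    exact pow_ne_zero 2 hX eA

theorem pattern_of_mul {n : ℕ} {c d c' d' g : k[X]} (hc : c = g * c') (hd : d = g * d')
    (h : (n % 3 = 0 → d.eval 0 = 0 ∧ c.eval 0 ≠ 0) ∧
      (n % 3 ≠ 0 → c.eval 0 = 0 ∧ d.eval 0 ≠ 0)) : ThreeTorsionPattern n c' d' := by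
  subst hc hd
  simp only [Polynomial.eval_mul, mul_eq_zero, mul_ne_zero_iff] at h
  exact ⟨fun hn => (h.1 hn).1.resolve_left (h.1 hn).2.1,
    fun hn => (h.2 hn).1.resolve_left (h.2 hn).2.1⟩

variable [DecidableEq K] [W.IsThreeTorsionForm] {y₀ : K}
  (hP : (W.map φ).toAffine.Nonsingular x₀ y₀) {p : ℕ}

/-- The quadratic with roots x(nP) and x((n + 2)P) has the known root a / b, so it splits as (b T -
a)(d T - c) over k[x]. Its coefficients have degree at most 2 M + 2, and the Gauss lemma at infinity
makes the heights of the factors add up. -/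
theorem exists_xRep_step (hφ : Function.Injective (Polynomial.eval₂ φ x₀)) (h6 : W.b₆ ≠ 0)
    (hp : p.Prime) (hp3 : p ≠ 3)
    (htors : ∀ j : ℕ, j • Point.some x₀ y₀ hP = 0 → p ∣ j) {n : ℕ} (hn : 1 ≤ n) (hnp : n + 2 ≤ p)
    {x₁ x₂ : K} {a b X Z : k[X]} {m M : ℕ}
    (h₁ : XRep W φ x₀ (n • Point.some x₀ y₀ hP) x₁ a b m)
    (h₂ : XRep W φ x₀ ((n + 1) • Point.some x₀ y₀ hP) x₂ X Z M)
    (hab : ThreeTorsionPattern n a b) (hXZ : ThreeTorsionPattern (n + 1) X Z) :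
    ∃ (x₃ : K) (c d : k[X]) (m' : ℕ),
      XRep W φ x₀ ((n + 2) • Point.some x₀ y₀ hP) x₃ c d m' ∧
      ThreeTorsionPattern (n + 2) c d ∧ m + m' ≤ 2 * M + 2 := by
  set P := Point.some x₀ y₀ hP with hPdef
  obtain ⟨y₁, k₁, eP₁⟩ := h₁.eq_some
  obtain ⟨y₂, k₂, eP₂⟩ := h₂.eq_some
  have eA := eval₂_addSubA (φ := φ) h₂.eval_eq
  have eB := eval₂_addSubB (W := W) h₂.eval_eq
  have eC := eval₂_addSubC (W := W) h₂.eval_eq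
  have rel₁ := addX_relation k₂ ((nonsingular_neg _ _).mpr hP) k₁ (by
    rw [← Point.neg_some hP, ← hPdef, ← eP₁, ← eP₂, succ_nsmul, add_neg_cancel_right])
  simp only [map_b₂, map_b₄, map_b₆] at rel₁
  have hr : addSubA X Z * a ^ 2 - addSubB W X Z * a * b + addSubC W X Z * b ^ 2 = 0 := by
    apply hφ
    simp only [Polynomial.eval₂_add, Polynomial.eval₂_sub, Polynomial.eval₂_mul,
      Polynomial.eval₂_pow, Polynomial.eval₂_zero, eA, eB, eC, ← h₁.eval_eq]
    linear_combination Z.eval₂ φ x₀ ^ 2 * b.eval₂ φ x₀ ^ 2 * rel₁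
  obtain ⟨c, d, hA, hB, hC⟩ := Polynomial.exists_linear_cofactor h₁.isCoprime hr
  have hpat := pattern_step h6 hab hXZ h₁.eval_zero_ne h₂.eval_zero_ne hA hB hC
  have hb := h₁.right_ne_zero hφ
  have hbe : b.eval₂ φ x₀ ≠ 0 := fun h0 => hb (hφ (by rw [h0, Polynomial.eval₂_zero]))
  have hsum : (n + 1) • P + P = (n + 2) • P := (succ_nsmul P (n + 1)).symm
  -- If (n + 2)P = O, then n + 2 = p and x₂ = x₀, so the leading coefficient b d vanishes. But 3 ∤
  -- p, and then the pattern gives d(0) ≠ 0.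
  have hne : (n + 2) • P ≠ 0 := by
    intro h0
    have hdvd := htors _ h0
    have hnp' : n + 2 = p := le_antisymm hnp (Nat.le_of_dvd (by omega) hdvd)
    have h3 : (n + 2) % 3 ≠ 0 := by
      rw [hnp']
      intro h
      exact hp3 ((Nat.prime_dvd_prime_iff_eq Nat.prime_three hp).mp
        (Nat.dvd_of_mod_eq_zero h)).symm
    have hd : d ≠ 0 := by
      rintro rfl
      simpa using (hpat.2 h3).2
    have hx : x₂ = x₀ := by
      rw [← hsum, add_eq_zero_iff_eq_neg, eP₂, hPdef, Point.neg_some, Point.some.injEq] at h0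
      exact h0.1
    rw [hx, sub_self, zero_pow two_ne_zero, mul_zero] at eA
    have : addSubA X Z = 0 := hφ (by rw [eA, Polynomial.eval₂_zero])
    rw [this] at hA
    exact mul_ne_zero hb hd hA
  rcases hQ : (n + 2) • P with _ | ⟨x₃, y₃, k₃⟩
  · exact absurd hQ hne
  have rel₂ := addX_relation k₂ hP k₃ (by rw [← eP₂, ← hPdef, hsum, hQ])
  simp only [map_b₂, map_b₄, map_b₆] at rel₂
  have hfac : (b.eval₂ φ x₀ * x₃ - a.eval₂ φ x₀) * (d.eval₂ φ x₀ * x₃ - c.eval₂ φ x₀) = 0 := by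
    have e₁ := congrArg (Polynomial.eval₂ φ x₀) hA
    have e₂ := congrArg (Polynomial.eval₂ φ x₀) hB
    have e₃ := congrArg (Polynomial.eval₂ φ x₀) hC
    simp only [Polynomial.eval₂_mul, Polynomial.eval₂_add, eA, eB, eC] at e₁ e₂ e₃
    linear_combination Z.eval₂ φ x₀ ^ 2 * rel₂ + x₃ ^ 2 * e₁ - x₃ * e₂ + e₃
  -- If x₃ were the root a / b, then (n + 2)P = ± nP, so p would divide 2 or 2 (n + 1), whereas p ≥
  -- n + 2 ≥ 3.
  have hde : d.eval₂ φ x₀ * x₃ = c.eval₂ φ x₀ := by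
    rcases mul_eq_zero.mp hfac with h | h
    · exfalso
      rw [← h₁.eval_eq, ← mul_sub] at h
      have hx : x₃ = x₁ := sub_eq_zero.mp ((mul_eq_zero.mp h).resolve_left hbe)
      have hQ' : (n + 2) • P = n • P ∨ (n + 2) • P = -(n • P) := by
        rw [hQ, eP₁]
        exact Point.X_eq_iff.mp hx
      have hlt : ¬ p ∣ 2 := fun h => by
        have := Nat.le_of_dvd two_pos h
        omega
      rcases hQ' with h | h
      · rw [add_nsmul, add_eq_left] at h
        exact hlt (htors _ h)
      · rw [← add_eq_zero_iff_eq_neg, ← add_nsmul] at h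
        have h' := htors _ h
        rw [show n + 2 + n = 2 * (n + 1) by ring] at h'
        rcases hp.dvd_mul.mp h' with h'' | h''
        · exact hlt h''
        · have := Nat.le_of_dvd (by omega) h''
          omega
    · exact sub_eq_zero.mp h
  have hd : d ≠ 0 := by
    rintro rfl
    rw [Polynomial.eval₂_zero, zero_mul, eq_comm] at hde
    have hc : c = 0 := hφ (by rw [hde, Polynomial.eval₂_zero])
    subst hc
    by_cases h3 : (n + 2) % 3 = 0
    · simpa using (hpat.1 h3).2
    · simpa using (hpat.2 h3).2
  obtain ⟨c', d', g, m', hc, hd', hrep, hle⟩ := exists_xRep_of_eval_eq hφ k₃ hd hde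
  refine ⟨x₃, c', d', m', hrep, pattern_of_mul hc hd' hpat, ?_⟩
  have hgauss := h₁.height.add_le (Polynomial.pairHeight_max (a := c) hd) (N := 2 * M + 2)
    (by rw [hA]; exact natDegree_addSubA_le h₂.height.left_le h₂.height.right_le)
    (by rw [hB]; exact natDegree_addSubB_le h₂.height.left_le h₂.height.right_le)
    (by rw [hC]; exact natDegree_addSubC_le h₂.height.left_le h₂.height.right_le)
  omega

/-- The duplication formula, in which b₈ = 0. Its denominator is (2 y₀ + a₁ x₀ + a₃)² at x₀ and b₆
at 0; the latter makes it a nonzero polynomial, and the former then gives 2P ≠ O in every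
characteristic. -/
theorem exists_xRep_two (hφ : Function.Injective (Polynomial.eval₂ φ x₀)) (h6 : W.b₆ ≠ 0) :
    ∃ (x : K) (c d : k[X]) (m : ℕ), XRep W φ x₀ (2 • Point.some x₀ y₀ hP) x c d m ∧
      ThreeTorsionPattern 2 c d ∧ m ≤ 4 := by
  let d : k[X] := 4 * Polynomial.X ^ 3 + Polynomial.C W.b₂ * Polynomial.X ^ 2
    + Polynomial.C (2 * W.b₄) * Polynomial.X + Polynomial.C W.b₆
  let c : k[X] := Polynomial.X ^ 4 - Polynomial.C W.b₄ * Polynomial.X ^ 2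
    - Polynomial.C (2 * W.b₆) * Polynomial.X
  have hd0 : d.eval 0 = W.b₆ := by simp [d]
  have hc0 : c.eval 0 = 0 := by simp [c]
  have hd : d ≠ 0 := by
    intro h
    rw [h, Polynomial.eval_zero] at hd0
    exact h6 hd0.symm
  have hde : d.eval₂ φ x₀ = 4 * x₀ ^ 3 + φ W.b₂ * x₀ ^ 2 + 2 * φ W.b₄ * x₀ + φ W.b₆ := by
    simp only [d, Polynomial.eval₂_add, Polynomial.eval₂_mul, Polynomial.eval₂_pow,
      Polynomial.eval₂_X, Polynomial.eval₂_C, Polynomial.eval₂_ofNat, map_mul, map_ofNat]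
  have hce : c.eval₂ φ x₀ = x₀ ^ 4 - φ W.b₄ * x₀ ^ 2 - 2 * φ W.b₆ * x₀ := by
    simp only [c, Polynomial.eval₂_sub, Polynomial.eval₂_mul, Polynomial.eval₂_pow,
      Polynomial.eval₂_X, Polynomial.eval₂_C, Polynomial.eval₂_ofNat, map_mul, map_ofNat]
  have hne : 2 • Point.some x₀ y₀ hP ≠ 0 := by
    intro h0
    rw [two_nsmul, add_eq_zero_iff_eq_neg, Point.neg_some, Point.some.injEq, negY] at h0
    have h1 : 2 * y₀ + φ W.a₁ * x₀ + φ W.a₃ = 0 := by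
      have := h0.2
      simp only [map_a₁, map_a₃] at this
      linear_combination this
    have heq := (equation_iff _ _).mp hP.1
    simp only [map_a₁, map_a₃, IsThreeTorsionForm.a₂, IsThreeTorsionForm.a₄,
      IsThreeTorsionForm.a₆] at heq
    refine hd (hφ ?_)
    rw [hde, Polynomial.eval₂_zero]
    simp only [b₂, b₄, b₆, IsThreeTorsionForm.a₂, IsThreeTorsionForm.a₄, IsThreeTorsionForm.a₆,
      map_add, map_mul, map_pow, map_ofNat, map_zero]
    linear_combination (2 * y₀ + φ W.a₁ * x₀ + φ W.a₃) * h1 - 4 * heq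
  rcases hQ : 2 • Point.some x₀ y₀ hP with _ | ⟨x, y, h⟩
  · exact absurd hQ hne
  have rel := addX_relation hP hP h (by rw [← two_nsmul, hQ])
  simp only [map_b₂, map_b₄, map_b₆] at rel
  obtain ⟨c', d', g, m, hc', hd', hrep, hle⟩ := exists_xRep_of_eval_eq hφ h (c := c) hd (by
    rw [hde, hce]
    linear_combination -rel)
  refine ⟨x, c', d', m, hrep, pattern_of_mul hc' hd' ⟨by simp, fun _ => ⟨hc0, ?_⟩⟩, ?_⟩
  · rwa [hd0]
  · have h1 : d.natDegree ≤ 4 := by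
      simp only [d]
      compute_degree
      omega
    have h2 : c.natDegree ≤ 4 := by
      simp only [c]
      compute_degree
    exact hle.trans (max_le h2 h1)

omit [W.IsThreeTorsionForm] in
theorem xRep_one : XRep W φ x₀ (1 • Point.some x₀ y₀ hP) x₀ Polynomial.X 1 1 :=
  ⟨⟨y₀, hP, one_nsmul _⟩, by simp, isCoprime_one_right, by simp, by simp, by simp⟩

/-- The `x`-coordinate of `p` times a generic point is a fraction of height at most `p ^ 2`. -/
theorem exists_xRep_prime (hφ : Function.Injective (Polynomial.eval₂ φ x₀)) (h6 : W.b₆ ≠ 0)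
    (hp : p.Prime) (hp3 : p ≠ 3)
    (htors : ∀ j : ℕ, j • Point.some x₀ y₀ hP = 0 → p ∣ j) :
    ∃ (x : K) (c d : k[X]) (m : ℕ), XRep W φ x₀ (p • Point.some x₀ y₀ hP) x c d m ∧
      m ≤ p ^ 2 := by
  -- The bound on the increments starts at 3 = 4 - 1 and grows by 2 at each step, as it does for the
  -- squares; both bounds are carried through the induction.
  have main : ∀ n : ℕ, n + 2 ≤ p → ∃ (x x' : K) (a b c d : k[X]) (m m' : ℕ),
      XRep W φ x₀ ((n + 1) • Point.some x₀ y₀ hP) x a b m ∧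
      XRep W φ x₀ ((n + 2) • Point.some x₀ y₀ hP) x' c d m' ∧
      ThreeTorsionPattern (n + 1) a b ∧ ThreeTorsionPattern (n + 2) c d ∧
      m' ≤ m + (2 * n + 3) ∧ m' ≤ (n + 2) ^ 2 := by
    intro n
    induction n with
    | zero =>
      intro _
      obtain ⟨x, c, d, m, h, hpat, hm⟩ := exists_xRep_two hP hφ h6
      exact ⟨x₀, x, Polynomial.X, 1, c, d, 1, m, xRep_one hP, h, ⟨by simp, by simp⟩, hpat,
        by omega, by omega⟩
    | succ n ih =>
      intro hn
      obtain ⟨x, x', a, b, c, d, m, m', h, h', hpat, hpat', hle, hsq⟩ := ih (by omega)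
      obtain ⟨x'', e, f, m'', h'', hpat'', hm''⟩ := exists_xRep_step hP hφ h6 hp hp3 htors
        (by omega) hn h h' hpat hpat'
      refine ⟨x', x'', c, d, e, f, m', m'', h', h'', hpat', hpat'', by omega, ?_⟩
      have : m'' ≤ (n + 2) ^ 2 + (2 * n + 5) := by omega
      exact this.trans (by nlinarith)
  obtain ⟨n, rfl⟩ := Nat.exists_eq_add_of_le' hp.two_le
  obtain ⟨x, x', a, b, c, d, m, m', h, h', hpat, hpat', hle, hsq⟩ := main n le_rfl
  exact ⟨x', c, d, m', h', hsq⟩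

end WeierstrassCurve

/-! ### Formal height at most two -/

namespace WeierstrassCurve

open WeierstrassCurve.Affine

variable {k : Type*} [Field k] (W : WeierstrassCurve k) [W.IsThreeTorsionForm]

local notation "ι" => algebraMap (MvPowerSeries Unit k) (FractionRing (MvPowerSeries Unit k))

theorem exists_wAt_eq_pow_three_mul {σ : Type*} {s : MvPowerSeries σ k}
    (hs : MvPowerSeries.constantCoeff s = 0) : ∃ u, IsUnit u ∧ W.wAt s = s ^ 3 * u := by
  obtain ⟨u, hu⟩ := (W.isUnit_wAt hs).exists_right_inv
  refine ⟨u, IsUnit.of_mul_eq_one _ ((mul_comm _ _).trans hu), ?_⟩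
  linear_combination u * W.wAt_mul hs - W.wAt s * hu

/-- At `x = 1 / Y`, where `Y` has no constant term, a polynomial has a pole whose order is its
degree times the order of `Y`. -/
theorem exists_eval₂_eq_mul_pow {Y : MvPowerSeries Unit k} (hY : Y ≠ 0)
    (hY0 : MvPowerSeries.constantCoeff Y = 0) {c : k[X]} (hc : c ≠ 0) :
    ∃ u, IsUnit u ∧ c.eval₂ (coeffHom Unit k) (ι Y)⁻¹ = ι u * (ι Y)⁻¹ ^ c.natDegree := by
  have hY' : ι Y ≠ 0 := algebraMap_ne_zero hY
  let : Invertible (ι Y)⁻¹ := invertibleOfNonzero (inv_ne_zero hY')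
  refine ⟨c.reverse.eval₂ MvPowerSeries.C Y, ?_, ?_⟩
  · rw [MvPowerSeries.isUnit_iff_constantCoeff, Polynomial.hom_eval₂, hY0,
      Polynomial.eval₂_at_zero, Polynomial.coeff_zero_reverse]
    simpa using hc
  · rw [← Polynomial.eval₂_reverse_mul_pow, Polynomial.hom_eval₂, invOf_eq_inv, inv_inv]
    rfl


section

variable {z t : MvPowerSeries Unit k}

/-- The double pole of x = z / w at O, since w(z) is z³ times a unit. -/
theorem exists_formal_x_eq_inv (hz : MvPowerSeries.constantCoeff z = 0) (hz0 : z ≠ 0) :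
    ∃ u, IsUnit u ∧ ι z / ι (W.wAt z) = (ι (z ^ 2 * u))⁻¹ := by
  obtain ⟨v, hvu, hv⟩ := W.exists_wAt_eq_pow_three_mul hz
  refine ⟨v, hvu, ?_⟩
  have h1 : ι z ≠ 0 := algebraMap_ne_zero hz0
  have h2 : ι v ≠ 0 := algebraMap_ne_zero hvu.ne_zero
  rw [hv]
  simp only [map_mul, map_pow]
  field_simp

/-- An element with a pole is transcendental over k: a nonzero polynomial in it has the pole order
dictated by its degree. -/
theorem eval₂_formal_x_injective (hz : MvPowerSeries.constantCoeff z = 0) (hz0 : z ≠ 0) :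
    Function.Injective (Polynomial.eval₂ (coeffHom Unit k) (ι z / ι (W.wAt z))) := by
  obtain ⟨v, hvu, hv⟩ := W.exists_formal_x_eq_inv hz hz0
  have hY : z ^ 2 * v ≠ 0 := mul_ne_zero (pow_ne_zero 2 hz0) hvu.ne_zero
  rw [hv]
  refine (injective_iff_map_eq_zero (Polynomial.eval₂RingHom (coeffHom Unit k) _)).mpr ?_
  intro c hc
  by_contra hc0
  obtain ⟨u, hu, e⟩ := exists_eval₂_eq_mul_pow hY (by simp [hz]) hc0
  rw [Polynomial.coe_eval₂RingHom, e] at hc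
  exact mul_ne_zero (algebraMap_ne_zero hu.ne_zero)
    (pow_ne_zero _ (inv_ne_zero (algebraMap_ne_zero hY))) hc

/-- The order of `t` in `z` is bounded by the degree of the fraction `c / d` with
`x(t) = c(x(z)) / d(x(z))`. -/
theorem sq_dvd_pow_of_eval₂_eq (hz : MvPowerSeries.constantCoeff z = 0) (hz0 : z ≠ 0)
    (ht : MvPowerSeries.constantCoeff t = 0) (ht0 : t ≠ 0) {c d : k[X]} (hd : d ≠ 0)
    (h : d.eval₂ (coeffHom Unit k) (ι z / ι (W.wAt z)) * (ι t / ι (W.wAt t)) =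
      c.eval₂ (coeffHom Unit k) (ι z / ι (W.wAt z))) : t ^ 2 ∣ z ^ (2 * c.natDegree) := by
  have hinj := W.eval₂_formal_x_injective hz hz0
  obtain ⟨v, hvu, hv⟩ := W.exists_formal_x_eq_inv hz hz0
  obtain ⟨v', hvu', hv'⟩ := W.exists_formal_x_eq_inv ht ht0
  have hY : z ^ 2 * v ≠ 0 := mul_ne_zero (pow_ne_zero 2 hz0) hvu.ne_zero
  have hY' : t ^ 2 * v' ≠ 0 := mul_ne_zero (pow_ne_zero 2 ht0) hvu'.ne_zero
  have hY0 : MvPowerSeries.constantCoeff (z ^ 2 * v) = 0 := by simp [hz]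
  have hc : c ≠ 0 := by
    rintro rfl
    rw [Polynomial.eval₂_zero, hv'] at h
    refine hd (hinj ?_)
    rw [Polynomial.eval₂_zero]
    exact (mul_eq_zero.mp h).resolve_right (inv_ne_zero (algebraMap_ne_zero hY'))
  rw [hv, hv'] at h
  obtain ⟨uc, huc, ec⟩ := exists_eval₂_eq_mul_pow hY hY0 hc
  obtain ⟨ud, hud, ed⟩ := exists_eval₂_eq_mul_pow hY hY0 hd
  rw [ec, ed] at h
  -- With x(z) = 1 / Y and x(t) = 1 / Y', clearing denominators shows that Y' divides Y ^ deg c up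
  -- to a unit.
  have key : ud * (z ^ 2 * v) ^ c.natDegree =
      uc * (z ^ 2 * v) ^ d.natDegree * (t ^ 2 * v') := by
    apply FaithfulSMul.algebraMap_injective _ (FractionRing (MvPowerSeries Unit k))
    have e₁ := algebraMap_ne_zero hY
    have e₂ := algebraMap_ne_zero hY'
    generalize z ^ 2 * v = Y at *
    generalize t ^ 2 * v' = Y' at *
    simp only [map_mul, map_pow]
    rw [inv_pow, inv_pow] at h
    field_simp at h
    linear_combination h
  have hdvd : t ^ 2 ∣ ud * (z ^ 2 * v) ^ c.natDegree := by
    rw [key]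
    exact Dvd.dvd.mul_left (dvd_mul_right _ _) _
  rwa [hud.dvd_mul_left, mul_pow, (hvu.pow _).dvd_mul_right, ← pow_mul] at hdvd

end

variable [W.IsElliptic]

theorem X_pow_dvd_multSeries (p : ℕ) [Fact p.Prime] [CharP k p]
    (hv : PowerSeries.coeff p (LevelThree.multSeries W.formalGroupLaw p) = 0)
    (hv2 : PowerSeries.coeff (p ^ 2) (LevelThree.multSeries W.formalGroupLaw p) = 0) :
    PowerSeries.X ^ (p ^ 2 + 1) ∣ LevelThree.multSeries W.formalGroupLaw p := by
  rw [PowerSeries.X_pow_dvd_iff]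
  intro m hm
  by_cases h : p ^ 2 ∣ m
  · rcases m.eq_zero_or_pos with rfl | hm0
    · simpa using W.constantCoeff_multSeries p
    · rwa [le_antisymm (Nat.lt_succ_iff.mp hm) (Nat.le_of_dvd hm0 h)]
  · exact W.coeff_multSeries_eq_zero_of_hasseInvariant_eq_zero p hv h

open Classical in
-- The linear coefficient of [j](z) is j, so [j](z) = 0 forces j = 0 in k.
theorem dvd_of_nsmul_formalPoint_X_eq_zero (p : ℕ) [CharP k p] {z : MvPowerSeries Unit k}
    (hz : MvPowerSeries.constantCoeff z = 0) (hzX : z = (PowerSeries.X : PowerSeries k)) (j : ℕ)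
    (hj : j • W.formalPoint z hz = 0) : p ∣ j := by
  rw [← W.formalPoint_mulAt j hz, formalPoint_eq_zero_iff, hzX] at hj
  have h0 : LevelThree.multSeries W.formalGroupLaw j = 0 := (PowerSeries.X_subst _).symm.trans hj
  have h1 := W.coeff_one_multSeries j
  rw [h0, map_zero] at h1
  exact (CharP.cast_eq_zero_iff k p j).mp h1.symm

open Classical in
theorem mulAt_X_sq_dvd (p : ℕ) [Fact p.Prime] [CharP k p] (hp3 : p ≠ 3) (h3 : W.a₃ ≠ 0)
    {z : MvPowerSeries Unit k} (hz : MvPowerSeries.constantCoeff z = 0)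
    (hzX : z = (PowerSeries.X : PowerSeries k)) : W.mulAt p z ^ 2 ∣ z ^ (2 * p ^ 2) := by
  have hp : p.Prime := Fact.out
  have hz0 : z ≠ 0 := by
    rw [hzX]
    exact PowerSeries.X_ne_zero
  have ht := W.constantCoeff_mulAt p hz
  have hφ := W.eval₂_formal_x_injective hz hz0
  have h6 : W.b₆ ≠ 0 := by
    simpa [b₆] using h3
  have hPz := W.formalPoint_of_ne_zero hz hz0
  have htors : ∀ j : ℕ, j • Point.some _ _ (W.nonsingular_formal hz hz0) = 0 → p ∣ j := by
    rw [← hPz]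
    exact W.dvd_of_nsmul_formalPoint_X_eq_zero p hz hzX
  obtain ⟨x, c, d, m, hrep, hm⟩ := exists_xRep_prime (W := W) (φ := coeffHom Unit k)
    (W.nonsingular_formal hz hz0) hφ h6 hp hp3 htors
  rw [← hPz, ← W.formalPoint_mulAt p hz] at hrep
  obtain ⟨y, hxy, hQ⟩ := hrep.eq_some
  have ht0 : W.mulAt p z ≠ 0 := by
    intro h0
    rw [(W.formalPoint_eq_zero_iff ht).mpr h0] at hQ
    exact Point.some_ne_zero hxy hQ.symm
  rw [W.formalPoint_of_ne_zero ht ht0, Point.some.injEq] at hQ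
  have heval := hrep.eval_eq
  rw [← hQ.1] at heval
  refine (W.sq_dvd_pow_of_eval₂_eq hz hz0 ht ht0 (hrep.right_ne_zero hφ) heval).trans ?_
  exact pow_dvd_pow _ (Nat.mul_le_mul_left 2 (hrep.height.left_le.trans hm))

/-- Over a field of characteristic `p ≠ 3`, a curve `y² + a₁ x y + a₃ y = x³` whose Hasse invariant
vanishes has formal height two. -/
theorem coeff_sq_multSeries_ne_zero (p : ℕ) [Fact p.Prime] [CharP k p] (hp3 : p ≠ 3)
    (h3 : W.a₃ ≠ 0)
    (hv : PowerSeries.coeff p (LevelThree.multSeries W.formalGroupLaw p) = 0) :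
    PowerSeries.coeff (p ^ 2) (LevelThree.multSeries W.formalGroupLaw p) ≠ 0 := by
  intro hv2
  have h1 := W.X_pow_dvd_multSeries p hv hv2
  have h2 : LevelThree.multSeries W.formalGroupLaw p ^ 2 ∣
      (PowerSeries.X : PowerSeries k) ^ (2 * p ^ 2) := by
    have h := W.mulAt_X_sq_dvd p hp3 h3 (z := (PowerSeries.X : PowerSeries k))
      PowerSeries.constantCoeff_X rfl
    have e : W.mulAt p (PowerSeries.X : PowerSeries k) = LevelThree.multSeries W.formalGroupLaw p :=
      PowerSeries.X_subst _
    rw [e] at h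
    exact h
  -- The order of [p]² is at least 2 (p² + 1) by the vanishing of v_1 and v_2, and at most 2 p² by
  -- the height bound.
  have h3 := (pow_dvd_pow_of_dvd h1 2).trans h2
  rw [← pow_mul, pow_dvd_pow_iff PowerSeries.X_ne_zero PowerSeries.X_prime.not_isUnit] at h3
  omega

end WeierstrassCurve

/-! ### Base change, and the nodal cubic -/

namespace WeierstrassCurve

section Map

variable {R S : Type*} [CommRing R] [CommRing S] (φ : R →+* S) (W : WeierstrassCurve R)

theorem map_formalStep (w : PowerSeries R) :
    (W.formalStep w).map φ = (W.map φ).formalStep (w.map φ) := by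
  simp [formalStep]

theorem map_formalW : W.formalW.map φ = (W.map φ).formalW := by
  have h : ∀ n, (W.formalStep^[n] 0).map φ = (W.map φ).formalStep^[n] 0 := by
    intro n
    induction n with
    | zero => simp
    | succ n ih => rw [Function.iterate_succ_apply', Function.iterate_succ_apply', map_formalStep, ih]
  ext n
  rw [PowerSeries.coeff_map, formalW, formalW, PowerSeries.coeff_mk, PowerSeries.coeff_mk, ← h,
    PowerSeries.coeff_map]

theorem map_formalSlope : W.formalSlope.map φ = (W.map φ).formalSlope := by
  ext d
  rw [MvPowerSeries.coeff_map]
  change φ (PowerSeries.coeff (d 0 + d 1 + 1) W.formalW) =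
    PowerSeries.coeff (d 0 + d 1 + 1) (W.map φ).formalW
  rw [← map_formalW, PowerSeries.coeff_map]

variable [W.IsThreeTorsionForm]

theorem map_formalThird : W.formalThird.map φ = (W.map φ).formalThird := by
  rw [formalThird_eq, formalThird_eq]
  simp only [thirdAt, slopeAt, MvPowerSeries.subst_pair_X]
  simp [map_formalSlope]

theorem constantCoeff_formalThird : MvPowerSeries.constantCoeff W.formalThird = 0 := by
  rw [formalThird_eq]
  exact W.constantCoeff_thirdAt (by simp) (by simp)

theorem map_formalGroupLaw : W.formalGroupLaw.map φ = (W.map φ).formalGroupLaw := by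
  have h₁ := congrArg (MvPowerSeries.map φ) W.formalGroupLaw_mul
  have h₂ := (W.map φ).formalGroupLaw_mul
  have hu := (W.map φ).isUnit_wAt (W.map φ).constantCoeff_formalThird
  have hw : (W.wAt W.formalThird).map φ = (W.map φ).wAt (W.map φ).formalThird := by
    rw [wAt, PowerSeries.map_subst (PowerSeries.HasSubst.of_constantCoeff_zero
      W.constantCoeff_formalThird), map_formalW, map_formalThird]
  simp only [map_mul, map_sub, map_one, map_neg, MvPowerSeries.map_C, map_formalThird, hw] at h₁
  rw [map_a₁, map_a₃] at h₂ hu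
  exact hu.mul_right_cancel (h₁.trans h₂.symm)

theorem map_multSeries (n : ℕ) : (LevelThree.multSeries W.formalGroupLaw n).map φ =
    LevelThree.multSeries (W.map φ).formalGroupLaw n := by
  induction n with
  | zero => simp [LevelThree.multSeries]
  | succ n ih =>
    have hb := MvPowerSeries.hasSubst_pair (σ := Unit) (W.constantCoeff_multSeries n)
      (PowerSeries.constantCoeff_X (R := R))
    rw [LevelThree.multSeries, LevelThree.multSeries, ← ih, ← map_formalGroupLaw]
    refine (MvPowerSeries.map_subst hb _).trans ?_
    congr 1
    ext i : 1
    fin_cases i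
    · rfl
    · exact PowerSeries.map_X φ

theorem map_landweberCoeff (p n : ℕ) : φ (LevelThree.landweberCoeff W.formalGroupLaw p n) =
    LevelThree.landweberCoeff (W.map φ).formalGroupLaw p n := by
  rw [LevelThree.landweberCoeff, LevelThree.landweberCoeff, ← map_multSeries, PowerSeries.coeff_map]

end Map

section Nodal

variable {R : Type*} [CommRing R] [IsDomain R] (W : WeierstrassCurve R) [W.IsThreeTorsionForm]

/-- The formal group law of the nodal cubic `y² + a₁ x y = x³` is multiplicative. -/
theorem formalGroupLaw_of_a₃_eq_zero (h : W.a₃ = 0) : W.formalGroupLaw =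
    MvPowerSeries.X 0 + MvPowerSeries.X 1
      - MvPowerSeries.C W.a₁ * MvPowerSeries.X 0 * MvPowerSeries.X 1 := by
  have hF := W.formalGroupLaw_mul
  have hu := W.isUnit_wAt W.constantCoeff_formalThird
  refine hu.mul_right_cancel (hF.trans ?_)
  have h0 : MvPowerSeries.constantCoeff (MvPowerSeries.X 0 : MvPowerSeries (Fin 2) R) = 0 := by simp
  have h1 : MvPowerSeries.constantCoeff (MvPowerSeries.X 1 : MvPowerSeries (Fin 2) R) = 0 := by simp
  have hl := W.sub_mul_slopeAt h0 h1
  have e0 := W.wAt_mul h0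
  have e1 := W.wAt_mul h1
  rw [formalThird_eq, thirdAt]
  -- For a₃ = 0 the curve equation is linear in w: w(z)(1 - a₁ z) = z³.
  simp only [h, map_zero, zero_mul, add_zero, sub_zero] at e0 e1 ⊢
  have hne : (MvPowerSeries.X 0 - MvPowerSeries.X 1 : MvPowerSeries (Fin 2) R) ≠ 0 := by
    rw [sub_ne_zero]
    intro h
    exact zero_ne_one ((MvPowerSeries.X_inj (R := R)).mp h)
  refine mul_left_cancel₀ hne ?_
  generalize W.slopeAt (MvPowerSeries.X 0) (MvPowerSeries.X 1) = l at *
  generalize W.wAt (MvPowerSeries.X 0) = w₀ at *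
  generalize W.wAt (MvPowerSeries.X 1) = w₁ at *
  generalize (MvPowerSeries.X 0 : MvPowerSeries (Fin 2) R) = x at *
  generalize (MvPowerSeries.X 1 : MvPowerSeries (Fin 2) R) = y at *
  generalize (MvPowerSeries.C W.a₁ : MvPowerSeries (Fin 2) R) = a at *
  linear_combination a * (1 - a * x) * (1 - a * y) * hl + a * (1 - a * y) * e0
    - a * (1 - a * x) * e1

/-- The series 1 - a₁ z is a multiplicative coordinate: 1 - a₁ F = (1 - a₁ X 0)(1 - a₁ X 1). -/
theorem one_sub_mul_multSeries (h : W.a₃ = 0) (n : ℕ) :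
    1 - PowerSeries.C W.a₁ * LevelThree.multSeries W.formalGroupLaw n =
      (1 - PowerSeries.C W.a₁ * PowerSeries.X) ^ n := by
  induction n with
  | zero => simp [LevelThree.multSeries]
  | succ n ih =>
    have hb := MvPowerSeries.hasSubst_pair (σ := Unit) (W.constantCoeff_multSeries n)
      (PowerSeries.constantCoeff_X (R := R))
    have e : LevelThree.multSeries W.formalGroupLaw (n + 1) =
        LevelThree.multSeries W.formalGroupLaw n + PowerSeries.X
          - PowerSeries.C W.a₁ * LevelThree.multSeries W.formalGroupLaw n * PowerSeries.X := by
      have := congrArg (MvPowerSeries.subst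
        ![LevelThree.multSeries W.formalGroupLaw n, PowerSeries.X])
        (W.formalGroupLaw_of_a₃_eq_zero h)
      rwa [MvPowerSeries.subst_sub hb, MvPowerSeries.subst_add hb, MvPowerSeries.subst_mul hb,
        MvPowerSeries.subst_mul hb, MvPowerSeries.subst_X hb, MvPowerSeries.subst_X hb,
        MvPowerSeries.subst_C] at this
    rw [pow_succ, ← ih, e]
    ring

theorem neg_mul_coeff_multSeries (h : W.a₃ = 0) {n : ℕ} (hn : n ≠ 0) :
    -W.a₁ * PowerSeries.coeff n (LevelThree.multSeries W.formalGroupLaw n) = (-W.a₁) ^ n := by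
  have e := congrArg (PowerSeries.coeff n) (W.one_sub_mul_multSeries h n)
  have e' : (1 - PowerSeries.C W.a₁ * PowerSeries.X : PowerSeries R) ^ n =
      (((1 - Polynomial.C W.a₁ * Polynomial.X) ^ n : R[X]) : PowerSeries R) := by
    simp
  have hd : (1 - Polynomial.C W.a₁ * Polynomial.X : R[X]).natDegree ≤ 1 := by compute_degree
  have hc := Polynomial.coeff_pow_of_natDegree_le (m := n) hd
  rw [mul_one] at hc
  rw [e', Polynomial.coeff_coe, hc, map_sub, PowerSeries.coeff_C_mul, PowerSeries.coeff_one,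
    if_neg hn] at e
  simp [Polynomial.coeff_one] at e
  rw [neg_mul, e]

end Nodal

end WeierstrassCurve

/-! ### Regularity in quotients and free algebras -/

theorem Ideal.Quotient.mk_mem_nonZeroDivisors_iff {R : Type*} [CommRing R] (I : Ideal R) (v : R) :
    Ideal.Quotient.mk I v ∈ nonZeroDivisors (R ⧸ I) ↔ ∀ x, v * x ∈ I → x ∈ I := by
  rw [mem_nonZeroDivisors_iff_right]
  constructor
  · intro h x hx
    rw [← Ideal.Quotient.eq_zero_iff_mem] at hx ⊢
    exact h _ (by rw [← map_mul, mul_comm, hx])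
  · intro h y hy
    obtain ⟨x, rfl⟩ := Ideal.Quotient.mk_surjective y
    rw [← map_mul, Ideal.Quotient.eq_zero_iff_mem, mul_comm] at hy
    exact Ideal.Quotient.eq_zero_iff_mem.mpr (h x hy)

/-- Regularity modulo an element of the base ring passes to a free algebra. -/
theorem Module.Basis.algebraMap_dvd_of_dvd_mul {A M ι : Type*} [CommRing A] [CommRing M] [Algebra A M]
    [Finite ι] (b : Module.Basis ι A M) {q v : A} (h : ∀ x, q ∣ v * x → q ∣ x) {x : M}
    (hx : algebraMap A M q ∣ algebraMap A M v * x) : algebraMap A M q ∣ x := by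
  have := Fintype.ofFinite ι
  obtain ⟨y, hy⟩ := hx
  rw [← Algebra.smul_def, ← Algebra.smul_def] at hy
  have hd : ∀ i, q ∣ b.repr x i := by
    intro i
    refine h _ ⟨b.repr y i, ?_⟩
    have := DFunLike.congr_fun (congrArg b.repr hy) i
    simpa using this
  choose c hc using hd
  refine ⟨∑ i, c i • b i, ?_⟩
  rw [← Algebra.smul_def, Finset.smul_sum]
  conv_lhs => rw [← b.sum_repr x]
  exact Finset.sum_congr rfl fun i _ => by rw [hc i, mul_smul]

/-! ### The rings B₀ and B, and Landweber exactness of the curve -/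

namespace LevelThree

/-- The element of `ℤ[ν]` inverted in `B₀`. -/
abbrev invertedElement : ℤ[X] := 3 * (Polynomial.X ^ 3 - 1)

theorem invertedElement_ne_zero : invertedElement ≠ 0 := by
  intro h
  have := congrArg (Polynomial.eval 0) h
  simp at this

theorem powers_le_nonZeroDivisors : Submonoid.powers invertedElement ≤ nonZeroDivisors ℤ[X] :=
  powers_le_nonZeroDivisors_of_noZeroDivisors invertedElement_ne_zero

instance : IsDomain B₀ := IsLocalization.isDomain_localization powers_le_nonZeroDivisors

theorem algebraMap_B₀_injective : Function.Injective (algebraMap ℤ[X] B₀) :=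
  IsLocalization.injective B₀ powers_le_nonZeroDivisors

theorem natCast_B₀_ne_zero {p : ℕ} (hp : p ≠ 0) : (p : B₀) ≠ 0 := by
  rw [← map_natCast (algebraMap ℤ[X] B₀), Ne, map_eq_zero_iff _ algebraMap_B₀_injective]
  exact_mod_cast hp

/-- An element of `ℤ[ν]` that is nonzero modulo `p` is regular on `B₀ / p`. -/
theorem natCast_dvd_of_dvd_mul {p : ℕ} (hp : p.Prime) (hp3 : p ≠ 3) {v : ℤ[X]}
    (hv : ¬ (p : ℤ[X]) ∣ v) {x : B₀} (hx : (p : B₀) ∣ algebraMap ℤ[X] B₀ v * x) :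
    (p : B₀) ∣ x := by
  have hprime : Prime (p : ℤ[X]) := by
    have := Polynomial.prime_C_iff.mpr (Nat.prime_iff_prime_int.mp hp)
    simpa using this
  -- At ν = 0 the inverted element is -3, so a prime p ≠ 3 does not divide it.
  have hs : ¬ (p : ℤ[X]) ∣ invertedElement := by
    rintro ⟨r, hr⟩
    have h := congrArg (Polynomial.eval 0) hr
    simp only [Polynomial.eval_mul, Polynomial.eval_natCast] at h
    have hd : (p : ℤ) ∣ -3 := ⟨_, by simpa using h⟩
    rw [dvd_neg] at hd
    exact hp3 ((Nat.prime_dvd_prime_iff_eq hp Nat.prime_three).mp (by exact_mod_cast hd))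
  obtain ⟨y, hy⟩ := hx
  obtain ⟨n, a, ha⟩ := IsLocalization.Away.surj invertedElement x
  obtain ⟨m, b, hb⟩ := IsLocalization.Away.surj invertedElement y
  have e : v * a * invertedElement ^ m = p * (b * invertedElement ^ n) := by
    apply algebraMap_B₀_injective
    rw [map_mul _ (v * a), map_mul _ v, map_pow, map_mul _ (p : ℤ[X]), map_mul _ b, map_pow,
      map_natCast, ← ha, ← hb]
    linear_combination (algebraMap ℤ[X] B₀ invertedElement) ^ n *
      (algebraMap ℤ[X] B₀ invertedElement) ^ m * hy
  have hda : (p : ℤ[X]) ∣ a := by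
    rcases hprime.dvd_or_dvd (Dvd.intro _ e.symm) with h | h
    · exact (hprime.dvd_or_dvd h).resolve_left hv
    · exact absurd (hprime.dvd_of_dvd_pow h) hs
  obtain ⟨c, rfl⟩ := hda
  have hu : IsUnit (algebraMap ℤ[X] B₀ invertedElement ^ n) :=
    (IsLocalization.Away.algebraMap_isUnit invertedElement).pow n
  rw [← hu.dvd_mul_right, ha, map_mul, map_natCast]
  exact dvd_mul_right _ _

instance : C₀.IsThreeTorsionForm := ⟨rfl, rfl, rfl⟩

instance : C.IsThreeTorsionForm := inferInstanceAs (C₀.map (algebraMap B₀ B)).IsThreeTorsionForm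

/-- The curve `y² + 3 ν x y + (ν³ - 1) y = x³` over `ℤ[ν]`. -/
def integralCurve : WeierstrassCurve ℤ[X] where
  a₁ := 3 * Polynomial.X
  a₂ := 0
  a₃ := Polynomial.X ^ 3 - 1
  a₄ := 0
  a₆ := 0

instance : integralCurve.IsThreeTorsionForm := ⟨rfl, rfl, rfl⟩

theorem map_integralCurve : integralCurve.map (algebraMap ℤ[X] B₀) = C₀ := by
  ext
  · simp only [integralCurve, C₀, ν, WeierstrassCurve.map_a₁, map_mul, map_ofNat]
  all_goals simp [integralCurve, C₀, ν]

/-- At ν = 1 the coefficient a₃ vanishes, so this point is missing from S₀. Over ℤ[ν] the equation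
still specializes there, to a nodal cubic with a₁ = 3, for which -3 v_1 = (-3)^p. -/
theorem not_dvd_landweberCoeff_integralCurve {p : ℕ} (hp : p.Prime) (hp3 : p ≠ 3) :
    ¬ (p : ℤ[X]) ∣ landweberCoeff integralCurve.formalGroupLaw p 1 := by
  intro h
  have h' := map_dvd (Polynomial.evalRingHom 1) h
  rw [WeierstrassCurve.map_landweberCoeff, map_natCast, landweberCoeff, pow_one] at h'
  have e := (integralCurve.map (Polynomial.evalRingHom 1)).neg_mul_coeff_multSeries
    (by simp [integralCurve]) hp.ne_zero
  have h3 := (h'.mul_left (-(integralCurve.map (Polynomial.evalRingHom 1)).a₁))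
  rw [e] at h3
  have h4 := (Nat.prime_iff_prime_int.mp hp).dvd_of_dvd_pow h3
  have h5 : (p : ℤ) ∣ 3 := by simpa [integralCurve] using h4
  exact hp3 ((Nat.prime_dvd_prime_iff_eq hp Nat.prime_three).mp (by exact_mod_cast h5))

theorem natCast_dvd_of_dvd_landweberCoeff_mul {p : ℕ} (hp : p.Prime) (hp3 : p ≠ 3) (x : B₀)
    (hx : (p : B₀) ∣ landweberCoeff C₀.formalGroupLaw p 1 * x) : (p : B₀) ∣ x := by
  rw [← map_integralCurve, ← WeierstrassCurve.map_landweberCoeff] at hx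
  exact natCast_dvd_of_dvd_mul hp hp3 (not_dvd_landweberCoeff_integralCurve hp hp3) hx

/-- The linear coefficient of [p] was determined over fields; since B₀ is a domain, the value
descends from its fraction field. -/
theorem landweberCoeff_C₀_zero (p : ℕ) : landweberCoeff C₀.formalGroupLaw p 0 = p := by
  apply FaithfulSMul.algebraMap_injective B₀ (FractionRing B₀)
  rw [WeierstrassCurve.map_landweberCoeff, landweberCoeff, pow_zero,
    WeierstrassCurve.coeff_one_multSeries, map_natCast]

theorem landweberCoeff_C (p n : ℕ) : landweberCoeff C.formalGroupLaw p n =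
    algebraMap B₀ B (landweberCoeff C₀.formalGroupLaw p n) :=
  (C₀.map_landweberCoeff (algebraMap B₀ B) p n).symm

theorem landweberCoeff_C_zero (p : ℕ) : landweberCoeff C.formalGroupLaw p 0 = p := by
  rw [landweberCoeff_C, landweberCoeff_C₀_zero, map_natCast]

theorem monic_cyclotomic_three : (1 + Polynomial.X + Polynomial.X ^ 2 : B₀[X]).Monic := by
  have h : (1 + Polynomial.X + Polynomial.X ^ 2 : B₀[X]) =
      Polynomial.X ^ 2 + (Polynomial.X + 1) := by ring
  rw [h]
  exact Polynomial.monic_X_pow_add ((Polynomial.degree_X_add_C 1).trans_lt (by norm_num))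

/-- A basis of `B` over `B₀`. -/
def basisB := (AdjoinRoot.powerBasis' monic_cyclotomic_three).basis

/-- Otherwise some residue field of B has characteristic p and v_1 = v_2 = 0 there. As ν³ - 1 is a
unit, a₃ stays nonzero, and the height bound is contradicted. -/
theorem landweberIdeal_C_three {p : ℕ} (hp : p.Prime) (hp3 : p ≠ 3) :
    landweberIdeal C.formalGroupLaw p 3 = ⊤ := by
  by_contra hne
  obtain ⟨M, hM, hle⟩ := Ideal.exists_le_maximal _ hne
  have hmem : ∀ n < 3, landweberCoeff (C.map (Ideal.Quotient.mk M)).formalGroupLaw p n = 0 := by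
    intro n hn
    rw [← WeierstrassCurve.map_landweberCoeff, Ideal.Quotient.eq_zero_iff_mem]
    exact hle (Ideal.subset_span ⟨n, hn, rfl⟩)
  let : Field (B ⧸ M) := Ideal.Quotient.field M
  have : Fact p.Prime := ⟨hp⟩
  have h0 := hmem 0 (by norm_num)
  rw [← WeierstrassCurve.map_landweberCoeff, landweberCoeff_C_zero, map_natCast] at h0
  have : CharP (B ⧸ M) p := ringChar.of_eq (CharP.ringChar_of_prime_eq_zero hp h0)
  have h1 := hmem 1 (by norm_num)
  rw [landweberCoeff, pow_one] at h1
  have h3 : (C.map (Ideal.Quotient.mk M)).a₃ ≠ 0 := by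
    have hu : IsUnit (ν ^ 3 - 1 : B₀) := isUnit_of_mul_isUnit_right isUnit_three_mul
    exact ((hu.map (algebraMap B₀ B)).map (Ideal.Quotient.mk M)).ne_zero
  exact WeierstrassCurve.coeff_sq_multSeries_ne_zero (C.map (Ideal.Quotient.mk M)) p hp3 h3 h1
    (hmem 2 (by norm_num))

theorem landweberIdeal_mono {R : Type*} [CommRing R] (F : MvPowerSeries (Fin 2) R) (p : ℕ) {m n : ℕ}
    (h : m ≤ n) : landweberIdeal F p m ≤ landweberIdeal F p n :=
  Ideal.span_mono (Set.image_mono (Set.Iio_subset_Iio h))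

theorem landweberIdeal_succ {R : Type*} [CommRing R] (F : MvPowerSeries (Fin 2) R) (p n : ℕ) :
    landweberIdeal F p (n + 1) = landweberIdeal F p n ⊔ Ideal.span {landweberCoeff F p n} := by
  rw [landweberIdeal, landweberIdeal, ← Ideal.span_union, ← Set.image_singleton, ← Set.image_union]
  congr 2
  ext i
  simp only [Set.mem_Iio, Set.mem_union, Set.mem_singleton_iff]
  omega

theorem landweberIdeal_zero {R : Type*} [CommRing R] (F : MvPowerSeries (Fin 2) R) (p : ℕ) :
    landweberIdeal F p 0 = ⊥ := by
  simp [landweberIdeal]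

theorem isLandweberExact_C : C.IsLandweberExact := by
  intro p hp n
  rw [Ideal.Quotient.mk_mem_nonZeroDivisors_iff]
  intro x hx
  rcases n with _ | _ | n
  · rw [landweberIdeal_zero, Ideal.mem_bot] at hx ⊢
    rw [landweberCoeff_C, landweberCoeff_C₀_zero] at hx
    apply basisB.ext_elem
    intro i
    rw [← Algebra.smul_def] at hx
    have := DFunLike.congr_fun (congrArg basisB.repr hx) i
    simp only [map_smul, map_zero, Finsupp.coe_zero, Pi.zero_apply, Finsupp.coe_smul, Pi.smul_apply,
      smul_eq_mul] at this ⊢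
    exact (mul_eq_zero.mp this).resolve_left (natCast_B₀_ne_zero hp.ne_zero)
  · rw [landweberIdeal_succ, landweberIdeal_zero, bot_sup_eq, landweberCoeff_C_zero,
      Ideal.mem_span_singleton] at hx ⊢
    by_cases hp3 : p = 3
    · subst hp3
      have hu : IsUnit (3 : B₀) := isUnit_of_mul_isUnit_left isUnit_three_mul
      have hu' := hu.map (algebraMap B₀ B)
      rw [map_ofNat] at hu'
      exact_mod_cast hu'.dvd
    · rw [← map_natCast (algebraMap B₀ B), landweberCoeff_C] at hx
      rw [← map_natCast (algebraMap B₀ B)]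
      exact basisB.algebraMap_dvd_of_dvd_mul
        (natCast_dvd_of_dvd_landweberCoeff_mul hp hp3) hx
  · by_cases hp3 : p = 3
    · have htop : landweberIdeal C.formalGroupLaw p (n + 2) = ⊤ := by
        refine Ideal.eq_top_of_isUnit_mem _ (x := (p : B)) ?_ ?_
        · rw [← landweberCoeff_C_zero]
          exact Ideal.subset_span ⟨0, by simp, rfl⟩
        · have hu : IsUnit (3 : B₀) := isUnit_of_mul_isUnit_left isUnit_three_mul
          have hu' := hu.map (algebraMap B₀ B)
          rw [map_ofNat] at hu'
          rw [hp3]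
          exact_mod_cast hu'
      rw [htop]
      trivial
    -- Adjoining the next coefficient already gives the unit ideal, so that coefficient is a unit
    -- modulo the preceding ones, hence regular even if the quotient is zero.
    · have htop : landweberIdeal C.formalGroupLaw p (n + 2) ⊔
          Ideal.span {landweberCoeff C.formalGroupLaw p (n + 2)} = ⊤ := by
        rw [← landweberIdeal_succ, eq_top_iff, ← landweberIdeal_C_three hp hp3]
        exact landweberIdeal_mono _ _ (by omega)
      obtain ⟨i, hi, j, hj, hij⟩ := Submodule.mem_sup.mp
        (htop ▸ Submodule.mem_top : (1 : B) ∈ landweberIdeal C.formalGroupLaw p (n + 2) ⊔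
          Ideal.span {landweberCoeff C.formalGroupLaw p (n + 2)})
      obtain ⟨r, rfl⟩ := Ideal.mem_span_singleton.mp hj
      have e : x = i * x + r * (landweberCoeff C.formalGroupLaw p (n + 2) * x) := by
        linear_combination -x * hij
      rw [e]
      exact add_mem (Ideal.mul_mem_right _ _ hi) (Ideal.mul_mem_left _ _ hx)

end LevelThree

end

/-- The elliptic curve `C` over `S = Spec B` is Landweber exact; every prime is a nonzerodivisor
in `B₀`; and for every prime `p ≠ 3` the Hasse invariant of the reduction of `C₀` modulo `p` is a
nonzerodivisor in `B₀ / p`. -/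
theorem mainTheorem6 :
    LevelThree.C.IsLandweberExact ∧
    (∀ p : ℕ, p.Prime → (p : LevelThree.B₀) ∈ nonZeroDivisors LevelThree.B₀) ∧
    (∀ p : ℕ, p.Prime → p ≠ 3 →
      (LevelThree.C₀.map
          (Ideal.Quotient.mk (Ideal.span {(p : LevelThree.B₀)}))).hasseInvariant p ∈
        nonZeroDivisors (LevelThree.B₀ ⧸ Ideal.span {(p : LevelThree.B₀)})) := by
  refine ⟨LevelThree.isLandweberExact_C, fun p hp => mem_nonZeroDivisors_of_ne_zero
    (LevelThree.natCast_B₀_ne_zero hp.ne_zero), fun p hp hp3 => ?_⟩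
  -- Multiplication series commute with base change, so the Hasse invariant of the reduction is the
  -- class of v_1.
  have e : (LevelThree.C₀.map
      (Ideal.Quotient.mk (Ideal.span {(p : LevelThree.B₀)}))).hasseInvariant p =
      Ideal.Quotient.mk _ (LevelThree.landweberCoeff LevelThree.C₀.formalGroupLaw p 1) := by
    rw [WeierstrassCurve.map_landweberCoeff, LevelThree.landweberCoeff, pow_one,
      WeierstrassCurve.hasseInvariant]
  rw [e, Ideal.Quotient.mk_mem_nonZeroDivisors_iff]
  intro x hx
  rw [Ideal.mem_span_singleton] at hx ⊢
  exact LevelThree.natCast_dvd_of_dvd_landweberCoeff_mul hp hp3 x hx
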